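/- Consider formulas $\varphi(x_1,\dots,x_k)=\exists u_1\dots\exists u_n\,\Phi(x,u)$ of bounded linear real arithmetic: $\Phi$ is a Boolean combination of comparisons ($\le,<,=$) between linear terms with rational coefficients over real variables, and each free variable $x_i$ has a domain $[a_i,b_i]$ with rational $a_i\le b_i$. (A bound on a quantified variable may be written into $\Phi$.) Let $\mathrm{mc}(\varphi)$ be the Lebesgue measure of the set of $x\in\prod_i[a_i,b_i]$ that satisfy $\varphi$. Then $\mathrm{mc}(\varphi)\le\prod_{i=1}^k(b_i-a_i)$, and there is a randomized algorithm with the following properties. It has access to an oracle that decides satisfiability of formulas in the combined theory of bounded integer arithmetic and linear real arithmetic (formulas as above that may also contain integer variables, each with a bounded integer domain, and in whose comparisons integer terms built from these variables and integer constants by addition and multiplication may occur as terms). Given $\varphi$ and a rational $\gamma>0$, the algorithm always halts within a number of steps that is bounded by a fixed polynomial in $|\varphi|+|\gamma|+\gamma^{-1}$, where $|\cdot|$ is the length of the encoding with numbers in binary; writing down an oracle query is charged its length, and the answer is returned in one step. Its output $A(\varphi,\gamma)\in\mathbb{Q}$ satisfies $$\Pr\Bigl[\,\bigl|A(\varphi,\gamma)-\mathrm{mc}(\varphi)\bigr|\le\gamma\prod_{i=1}^k(b_i-a_i)\Bigr]\ge\frac34,$$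 where the probability is over the internal coin tosses of the algorithm. -/

import Mathlib

open Set MeasureTheory

/-! ## Data values, programs, and step counts

The machine model: structured programs over finitely many registers.  A register holds a
finite binary tree whose leaves are integers in binary.  Arithmetic is charged by the bit
lengths of the operands, so the cost of a run is polynomially related to the running time of
a Turing machine that has the same oracle and the same coins. -/

/-- Data values: binary trees with integer leaves. -/
inductive Val : Type
  | int (z : ℤ) : Val
  | pair (a b : Val) : Val

namespace Val

/-- The length of a value: a leaf counts the bits of its integer and one for the sign. -/
def size : Val → ℕ
  | int z => z.natAbs.size + 1
  | pair a b => a.size + b.size + 1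

/-- The integer stored in a leaf (and `0` at an inner node). -/
def toInt : Val → ℤ
  | int z => z
  | pair _ _ => 0

/-- The left part of a pair (and the leaf `0` at a leaf). -/
def fst : Val → Val
  | int _ => int 0
  | pair a _ => a

/-- The right part of a pair (and the leaf `0` at a leaf). -/
def snd : Val → Val
  | int _ => int 0
  | pair _ b => b

/-- `1` for a pair, `0` for a leaf. -/
def isPair : Val → ℤ
  | int _ => 0
  | pair _ _ => 1

/-- Lists as values: the leaf `0` is the empty list. -/
def ofList : List Val → Val
  | [] => int 0
  | v :: l => pair v (ofList l)

end Val

/-- Arithmetic primitives on integers; `le` returns `1` or `0`, `div` rounds down and returns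
`0` when the divisor is `0`. -/
inductive ArithOp : Type
  | add | sub | mul | div | le

/-- The integer function that a primitive computes. -/
def ArithOp.apply : ArithOp → ℤ → ℤ → ℤ
  | add, x, y => x + y
  | sub, x, y => x - y
  | mul, x, y => x * y
  | div, x, y => Int.fdiv x y
  | le, x, y => if x ≤ y then 1 else 0

/-- Expressions over the registers. -/
inductive Expr : Type
  | reg (i : ℕ) : Expr
  | const (z : ℤ) : Expr
  | pair (e f : Expr) : Expr
  | fst (e : Expr) : Expr
  | snd (e : Expr) : Expr
  | isPair (e : Expr) : Expr
  | arith (o : ArithOp) (e f : Expr) : Expr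

namespace Expr

/-- The value of an expression. -/
def eval (σ : ℕ → Val) : Expr → Val
  | reg i => σ i
  | const z => Val.int z
  | pair e f => Val.pair (e.eval σ) (f.eval σ)
  | fst e => (e.eval σ).fst
  | snd e => (e.eval σ).snd
  | isPair e => Val.int (e.eval σ).isPair
  | arith o e f => Val.int (o.apply (e.eval σ).toInt (f.eval σ).toInt)

/-- The number of steps taken by the evaluation of an expression: one per pointer operation, and
the product of the lengths of the operands for an arithmetic operation. -/
def cost (σ : ℕ → Val) : Expr → ℕ
  | reg _ => 1
  | const _ => 1
  | pair e f => e.cost σ + f.cost σ + 1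
  | fst e => e.cost σ + 1
  | snd e => e.cost σ + 1
  | isPair e => e.cost σ + 1
  | arith _ e f => e.cost σ + f.cost σ +
      (Val.int (e.eval σ).toInt).size * (Val.int (f.eval σ).toInt).size

end Expr

/-- Programs: assignments, control flow, coin tosses and oracle queries. -/
inductive Prog : Type
  | assign (i : ℕ) (e : Expr) : Prog
  | seq (c d : Prog) : Prog
  | ite (e : Expr) (c d : Prog) : Prog
  | while (e : Expr) (c : Prog) : Prog
  | flip (i : ℕ) : Prog
  | query (i : ℕ) (e : Expr) : Prog

/-- `Exec O c σ r t σ' r'`: with oracle `O`, the program `c` started in the register contents `σ`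
with the remaining coin tosses `r` halts after exactly `t` steps, with register contents `σ'` and
unused coin tosses `r'`.  A query is charged for being written down; its answer takes one step. -/
inductive Exec (O : Val → Prop) :
    Prog → (ℕ → Val) → List Bool → ℕ → (ℕ → Val) → List Bool → Prop
  | assign (i : ℕ) (e : Expr) (σ : ℕ → Val) (r : List Bool) :
      Exec O (.assign i e) σ r (e.cost σ + 1) (Function.update σ i (e.eval σ)) r
  | seq {c d : Prog} {σ σ₁ σ₂ : ℕ → Val} {r r₁ r₂ : List Bool} {s t : ℕ} :
      Exec O c σ r s σ₁ r₁ → Exec O d σ₁ r₁ t σ₂ r₂ → Exec O (.seq c d) σ r (s + t) σ₂ r₂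
  | ite_true {e : Expr} {c d : Prog} {σ σ₁ : ℕ → Val} {r r₁ : List Bool} {t : ℕ} :
      (e.eval σ).toInt ≠ 0 → Exec O c σ r t σ₁ r₁ →
        Exec O (.ite e c d) σ r (e.cost σ + 1 + t) σ₁ r₁
  | ite_false {e : Expr} {c d : Prog} {σ σ₁ : ℕ → Val} {r r₁ : List Bool} {t : ℕ} :
      (e.eval σ).toInt = 0 → Exec O d σ r t σ₁ r₁ →
        Exec O (.ite e c d) σ r (e.cost σ + 1 + t) σ₁ r₁
  | while_true {e : Expr} {c : Prog} {σ σ₁ σ₂ : ℕ → Val} {r r₁ r₂ : List Bool} {s t : ℕ} :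
      (e.eval σ).toInt ≠ 0 → Exec O c σ r s σ₁ r₁ → Exec O (.while e c) σ₁ r₁ t σ₂ r₂ →
        Exec O (.while e c) σ r (e.cost σ + 1 + s + t) σ₂ r₂
  | while_false {e : Expr} {c : Prog} {σ : ℕ → Val} {r : List Bool} :
      (e.eval σ).toInt = 0 → Exec O (.while e c) σ r (e.cost σ + 1) σ r
  | flip (i : ℕ) (σ : ℕ → Val) (b : Bool) (r : List Bool) :
      Exec O (.flip i) σ (b :: r) 1 (Function.update σ i (Val.int (if b then 1 else 0))) r
  | query_yes {i : ℕ} {e : Expr} {σ : ℕ → Val} {r : List Bool} :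
      O (e.eval σ) →
        Exec O (.query i e) σ r (e.cost σ + (e.eval σ).size + 1)
          (Function.update σ i (Val.int 1)) r
  | query_no {i : ℕ} {e : Expr} {σ : ℕ → Val} {r : List Bool} :
      ¬ O (e.eval σ) →
        Exec O (.query i e) σ r (e.cost σ + (e.eval σ).size + 1)
          (Function.update σ i (Val.int 0)) r

/-- With oracle `O`, input `v` and coin tosses `r`, the program `c` halts within `T` steps with
output `w`.  Input and output are in register `0`; the other registers start at `0`. -/
def Prog.Outputs (O : Val → Prop) (c : Prog) (v : Val) (T : ℕ) (r : Fin T → Bool) (w : Val) :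
    Prop :=
  ∃ (t : ℕ) (σ : ℕ → Val) (r' : List Bool),
    Exec O c (Function.update (fun _ => Val.int 0) 0 v) (List.ofFn r) t σ r' ∧ t ≤ T ∧ σ 0 = w

/-- The probability of an event under `T` independent fair coin tosses. -/
noncomputable def coinProb (T : ℕ) (E : (Fin T → Bool) → Prop) : ℝ :=
  (Nat.card {r : Fin T → Bool // E r} : ℝ) / 2 ^ T

/-! ## Syntax and semantics of the theories -/

/-- Rational literals: fractions, not necessarily in lowest terms. -/
structure Frac : Type where
  num : ℤ
  den : ℕ
  den_pos : 0 < den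

/-- The rational number that a literal denotes. -/
def Frac.val (q : Frac) : ℚ := q.num / q.den

/-- The encoding of a rational literal. -/
def Frac.enc (q : Frac) : Val := .pair (.int q.num) (.int q.den)

/-- Linear terms over real variables indexed by `κ`, with rational coefficients. -/
inductive LinTerm (κ : Type) : Type
  | var (j : κ) : LinTerm κ
  | const (q : Frac) : LinTerm κ
  | add (s t : LinTerm κ) : LinTerm κ
  | smul (q : Frac) (t : LinTerm κ) : LinTerm κ

/-- The value of a linear term. -/
noncomputable def LinTerm.eval {κ : Type} (x : κ → ℝ) : LinTerm κ → ℝ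
  | .var j => x j
  | .const q => (q.val : ℝ)
  | .add s t => s.eval x + t.eval x
  | .smul q t => (q.val : ℝ) * t.eval x

/-- The encoding of a linear term, given one for the variables. -/
def LinTerm.enc {κ : Type} (e : κ → Val) : LinTerm κ → Val
  | .var j => .pair (.int 0) (e j)
  | .const q => .pair (.int 1) q.enc
  | .add s t => .pair (.int 2) (.pair (s.enc e) (t.enc e))
  | .smul q t => .pair (.int 3) (.pair q.enc (t.enc e))

/-- Terms of integer arithmetic (not necessarily linear) over integer variables indexed by `ι`. -/
inductive IntTerm (ι : Type) : Type
  | var (i : ι) : IntTerm ι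
  | const (c : ℤ) : IntTerm ι
  | add (s t : IntTerm ι) : IntTerm ι
  | mul (s t : IntTerm ι) : IntTerm ι

/-- The value of an integer term. -/
def IntTerm.eval {ι : Type} (z : ι → ℤ) : IntTerm ι → ℤ
  | .var i => z i
  | .const c => c
  | .add s t => s.eval z + t.eval z
  | .mul s t => s.eval z * t.eval z

/-- The encoding of an integer term, given one for the variables. -/
def IntTerm.enc {ι : Type} (e : ι → Val) : IntTerm ι → Val
  | .var i => .pair (.int 0) (e i)
  | .const c => .pair (.int 1) (.int c)
  | .add s t => .pair (.int 2) (.pair (s.enc e) (t.enc e))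
  | .mul s t => .pair (.int 3) (.pair (s.enc e) (t.enc e))

/-- Terms of the combined theory: linear in the real variables, and integer terms may be used
as summands. -/
inductive MixTerm (ι κ : Type) : Type
  | var (j : κ) : MixTerm ι κ
  | const (q : Frac) : MixTerm ι κ
  | add (s t : MixTerm ι κ) : MixTerm ι κ
  | smul (q : Frac) (t : MixTerm ι κ) : MixTerm ι κ
  | ofInt (t : IntTerm ι) : MixTerm ι κ

/-- The value of a term of the combined theory. -/
noncomputable def MixTerm.eval {ι κ : Type} (z : ι → ℤ) (x : κ → ℝ) : MixTerm ι κ → ℝ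
  | .var j => x j
  | .const q => (q.val : ℝ)
  | .add s t => s.eval z x + t.eval z x
  | .smul q t => (q.val : ℝ) * t.eval z x
  | .ofInt t => (t.eval z : ℝ)

/-- The encoding of a term of the combined theory, given ones for the variables. -/
def MixTerm.enc {ι κ : Type} (d : ι → Val) (e : κ → Val) : MixTerm ι κ → Val
  | .var j => .pair (.int 0) (e j)
  | .const q => .pair (.int 1) q.enc
  | .add s t => .pair (.int 2) (.pair (s.enc d e) (t.enc d e))
  | .smul q t => .pair (.int 3) (.pair q.enc (t.enc d e))
  | .ofInt t => .pair (.int 4) (t.enc d)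

/-- Quantifier-free formulas: Boolean combinations of comparisons between terms in `τ`. -/
inductive QF (τ : Type) : Type
  | le (s t : τ) : QF τ
  | lt (s t : τ) : QF τ
  | eq (s t : τ) : QF τ
  | not (φ : QF τ) : QF τ
  | and (φ ψ : QF τ) : QF τ
  | or (φ ψ : QF τ) : QF τ

/-- Truth of a quantifier-free formula, given the values of the terms. -/
def QF.Holds {τ : Type} (v : τ → ℝ) : QF τ → Prop
  | .le s t => v s ≤ v t
  | .lt s t => v s < v t
  | .eq s t => v s = v t
  | .not φ => ¬ φ.Holds v
  | .and φ ψ => φ.Holds v ∧ ψ.Holds v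
  | .or φ ψ => φ.Holds v ∨ ψ.Holds v

/-- The encoding of a quantifier-free formula, given one for the terms. -/
def QF.enc {τ : Type} (e : τ → Val) : QF τ → Val
  | .le s t => .pair (.int 0) (.pair (e s) (e t))
  | .lt s t => .pair (.int 1) (.pair (e s) (e t))
  | .eq s t => .pair (.int 2) (.pair (e s) (e t))
  | .not φ => .pair (.int 3) (φ.enc e)
  | .and φ ψ => .pair (.int 4) (.pair (φ.enc e) (ψ.enc e))
  | .or φ ψ => .pair (.int 5) (.pair (φ.enc e) (ψ.enc e))

/-- The encoding of an index, in binary. -/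
def encIdx {m : ℕ} (i : Fin m) : Val := .int (i.val : ℤ)

/-- The encoding of a real variable: a free one (`inl`) or a quantified one (`inr`). -/
def encVar {k n : ℕ} : Fin k ⊕ Fin n → Val
  | .inl i => .pair (.int 0) (encIdx i)
  | .inr j => .pair (.int 1) (encIdx j)

/-- The encoding of a block of `n` quantifiers (of length proportional to `n`). -/
def encBlock (n : ℕ) : Val := Val.ofList (List.replicate n (.int 0))

/-- Formulas `∃ u₁ … uₙ, body(x₁, …, x_k, u₁, …, uₙ)` of bounded linear real arithmetic.
The free variable `x i` has the domain `[lo i, hi i]`; bounds on a quantified variable are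
written into the body. -/
structure RAFormula : Type where
  k : ℕ
  n : ℕ
  lo : Fin k → Frac
  hi : Fin k → Frac
  lo_le_hi : ∀ i, (lo i).val ≤ (hi i).val
  body : QF (LinTerm (Fin k ⊕ Fin n))

namespace RAFormula

/-- The encoding of a formula of bounded linear real arithmetic. -/
def enc (φ : RAFormula) : Val :=
  .pair (Val.ofList (List.ofFn fun i => .pair (φ.lo i).enc (φ.hi i).enc))
    (.pair (encBlock φ.n) (φ.body.enc (LinTerm.enc encVar)))

/-- The set of models: the tuples in the box of domains that satisfy the formula. -/
def models (φ : RAFormula) : Set (Fin φ.k → ℝ) :=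
  {x | (∀ i, x i ∈ Icc ((φ.lo i).val : ℝ) ((φ.hi i).val : ℝ)) ∧
    ∃ u : Fin φ.n → ℝ, φ.body.Holds (LinTerm.eval (Sum.elim x u))}

/-- The model count: the Lebesgue measure of the set of models. -/
noncomputable def modelCount (φ : RAFormula) : ℝ := (volume φ.models).toReal

/-- The a priori upper bound `∏ (bᵢ - aᵢ)` on the model count. -/
noncomputable def boxVolume (φ : RAFormula) : ℝ :=
  ∏ i, (((φ.hi i).val : ℝ) - ((φ.lo i).val : ℝ))

end RAFormula

/-- Formulas of the combined theory of bounded integer arithmetic and linear real arithmetic: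
integer variables `z i` with domains `[zlo i, zhi i]`, free real variables `x i` with domains
`[lo i, hi i]`, and existentially quantified real variables `u j`.  (For satisfiability it makes
no difference whether an integer variable is free or existentially quantified.) -/
structure MixFormula : Type where
  m : ℕ
  k : ℕ
  n : ℕ
  zlo : Fin m → ℤ
  zhi : Fin m → ℤ
  lo : Fin k → Frac
  hi : Fin k → Frac
  body : QF (MixTerm (Fin m) (Fin k ⊕ Fin n))

namespace MixFormula

/-- The encoding of a formula of the combined theory. -/
def enc (ψ : MixFormula) : Val :=
  .pair (Val.ofList (List.ofFn fun i => .pair (.int (ψ.zlo i)) (.int (ψ.zhi i))))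
    (.pair (Val.ofList (List.ofFn fun i => .pair (ψ.lo i).enc (ψ.hi i).enc))
      (.pair (encBlock ψ.n) (ψ.body.enc (MixTerm.enc encIdx encVar))))

/-- Satisfiability in the combined theory. -/
def Sat (ψ : MixFormula) : Prop :=
  ∃ (z : Fin ψ.m → ℤ) (x : Fin ψ.k → ℝ) (u : Fin ψ.n → ℝ),
    (∀ i, z i ∈ Icc (ψ.zlo i) (ψ.zhi i)) ∧
    (∀ i, x i ∈ Icc ((ψ.lo i).val : ℝ) ((ψ.hi i).val : ℝ)) ∧
    ψ.body.Holds (MixTerm.eval z (Sum.elim x u))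

end MixFormula

/-- The satisfiability oracle for the combined theory: it accepts exactly the encodings of
satisfiable formulas. -/
def mixSatOracle (v : Val) : Prop := ∃ ψ : MixFormula, ψ.enc = v ∧ ψ.Sat

/-!
# Approximate model counting for bounded linear real arithmetic

The error allowed is additive, and the running time may be polynomial in `1 / γ`, so plain Monte
Carlo sampling suffices: draw random points of the box, ask the oracle which of them satisfy the
formula, and return the volume of the box times the fraction of successes.  The query for a
rational point is the formula itself with every domain shrunk to that point, so that no integer
variables are needed (`RAFormula.mixSatOracle_atPoint`).  That an oracle query is answered
according to the formula it was made from rests on unique readability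
(`MixFormula.enc_injective`).

A machine can only sample from a finite grid.  The points that satisfy a formula with `A`
comparisons form a union of `3 ^ A` convex sets, one for each sign pattern of the comparisons,
because a projection of a convex set is convex (`RAFormula.isConvexUnion_solutions`).  A line
meets each of these sets in an interval, which leaves all but two cells of a grid on the line
uncut; by Fubini's theorem and induction on the dimension, an `N × ⋯ × N` grid in dimension `k`
therefore approximates the measure up to `2 * k * 3 ^ A / N` times the volume of the box
(`grid_approx`).  Since `k + A` is at most the number `c` of inner nodes of the encoding, `2 * c +
s + 2` random binary digits per coordinate, with `s ≥ 1 / γ`, make this error at most `γ / 2`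
(`RAFormula.abs_modelCount_sub_le`).  By Chebyshev's inequality `4 * s ^ 2` trials make the
statistical error at most `γ / 2` with probability at least `3 / 4` (`hitCount_concentration`).

The program `approxCount` carries this out.  Its cost is bounded by the number of primitive steps
times the cost of one step, which is quadratic in a common bound on the sizes of all registers
(`Reach`, `BoundedBy.cost_le`); each loop is handled by an induction that maintains such a bound
(`reach_approxCount`).
-/

/-! ### Discretizing the volume of a union of convex sets -/

/-- `S` is a union of `M` convex sets (which may overlap and may be empty). -/
def IsConvexUnion {E : Type*} [AddCommGroup E] [Module ℝ E] (M : ℕ) (S : Set E) : Prop :=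
  ∃ C : Fin M → Set E, (∀ i, Convex ℝ (C i)) ∧ S = ⋃ i, C i

namespace IsConvexUnion

theorem preimage {E F : Type*} [AddCommGroup E] [Module ℝ E] [AddCommGroup F] [Module ℝ F]
    {M : ℕ} {S : Set F} (hS : IsConvexUnion M S) (f : E → F)
    (hf : ∀ (x y : E) (a b : ℝ), a + b = 1 → f (a • x + b • y) = a • f x + b • f y) :
    IsConvexUnion M (f ⁻¹' S) := by
  obtain ⟨C, hC, rfl⟩ := hS
  refine ⟨fun i => f ⁻¹' C i, fun i x hx y hy a b ha hb hab => ?_, by simp⟩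
  rw [mem_preimage, hf x y a b hab]
  exact hC i hx hy ha hb hab

theorem nullMeasurableSet {E : Type*} [NormedAddCommGroup E] [NormedSpace ℝ E] [MeasurableSpace E]
    [BorelSpace E] [FiniteDimensional ℝ E] (μ : Measure E) [μ.IsAddHaarMeasure]
    {M : ℕ} {S : Set E} (hS : IsConvexUnion M S) : NullMeasurableSet S μ := by
  obtain ⟨C, hC, rfl⟩ := hS
  exact NullMeasurableSet.iUnion fun i => (hC i).nullMeasurableSet μ

theorem measurableSet {M : ℕ} {S : Set ℝ} (hS : IsConvexUnion M S) : MeasurableSet S := by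
  obtain ⟨C, hC, rfl⟩ := hS
  exact MeasurableSet.iUnion fun i => (hC i).ordConnected.measurableSet

end IsConvexUnion

/-- Among the cells of a grid on the line, at most two meet both a convex set and its
complement: a cell strictly between two cells that meet the set lies inside it. -/
theorem card_mixed_cells_le_two {C : Set ℝ} (hC : Convex ℝ C) (a : ℝ) {h : ℝ} (hh : 0 ≤ h) (N : ℕ)
    [DecidablePred fun j : ℕ => (∃ x ∈ Icc (a + h * j) (a + h * (j + 1)), x ∈ C) ∧
      ∃ x ∈ Icc (a + h * j) (a + h * (j + 1)), x ∉ C] :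
    ((Finset.range N).filter fun j : ℕ => (∃ x ∈ Icc (a + h * j) (a + h * (j + 1)), x ∈ C) ∧
      ∃ x ∈ Icc (a + h * j) (a + h * (j + 1)), x ∉ C).card ≤ 2 := by
  set s := (Finset.range N).filter fun j : ℕ => (∃ x ∈ Icc (a + h * j) (a + h * (j + 1)), x ∈ C) ∧
      ∃ x ∈ Icc (a + h * j) (a + h * (j + 1)), x ∉ C with hs
  by_contra hcard
  have key : ∀ i ∈ s, ∀ j ∈ s, ∀ k ∈ s, i < j → j < k → False := by
    intro i hi j hj k hk hij hjk
    simp only [hs, Finset.mem_filter] at hi hj hk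
    obtain ⟨p, hp, hpC⟩ := hi.2.1
    obtain ⟨q, hq, hqC⟩ := hk.2.1
    obtain ⟨x, hx, hxC⟩ := hj.2.2
    have h1 : (i : ℝ) + 1 ≤ j := by exact_mod_cast hij
    have h2 : (j : ℝ) + 1 ≤ k := by exact_mod_cast hjk
    have h3 := mul_le_mul_of_nonneg_left h1 hh
    have h4 := mul_le_mul_of_nonneg_left h2 hh
    refine hxC (hC.ordConnected.out hpC hqC ⟨?_, ?_⟩)
    · linarith [hp.2, hx.1]
    · linarith [hq.1, hx.2]
  obtain ⟨x, hx, y, hy, z, hz, hxy, hxz, hyz⟩ := Finset.two_lt_card.1 (not_le.1 hcard)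
  rcases lt_trichotomy x y with h1 | h1 | h1 <;> rcases lt_trichotomy y z with h2 | h2 | h2 <;>
    rcases lt_trichotomy x z with h3 | h3 | h3 <;>
    first
      | exact absurd h1 hxy
      | exact absurd h2 hyz
      | exact absurd h3 hxz
      | exact key _ hx _ hy _ hz h1 h2
      | exact key _ hx _ hz _ hy h3 h2
      | exact key _ hy _ hx _ hz h1 h3
      | exact key _ hy _ hz _ hx h2 h3
      | exact key _ hz _ hx _ hy h3 h1
      | exact key _ hz _ hy _ hx h2 h1

/-- The one-dimensional case of `grid_approx`. -/
theorem grid_approx_one {M N : ℕ} (hN : 0 < N) {a b : ℝ} (hab : a ≤ b) {S : Set ℝ}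
    (hS : IsConvexUnion M S) :
    |(∫ x in a..b, S.indicator (fun _ => (1 : ℝ)) x) -
      (b - a) / N * ∑ j : Fin N, S.indicator (fun _ => (1 : ℝ)) (a + (b - a) * (j : ℕ) / N)|
      ≤ (b - a) * (2 * M / N) := by
  classical
  have hSm := hS.measurableSet
  obtain ⟨C, hC, hSC⟩ := hS
  set h : ℝ := (b - a) / N with hh
  have hN' : (0 : ℝ) < N := by exact_mod_cast hN
  have hh0 : 0 ≤ h := div_nonneg (by linarith) hN'.le
  set f : ℝ → ℝ := S.indicator (fun _ => (1 : ℝ)) with hf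
  set bad : ℕ → Prop := fun j => ∃ i, (∃ x ∈ Icc (a + h * j) (a + h * (j + 1)), x ∈ C i) ∧
      ∃ x ∈ Icc (a + h * j) (a + h * (j + 1)), x ∉ C i with hbad
  have hint : ∀ c d : ℝ, IntervalIntegrable f volume c d := fun c d =>
    have h1 : IntervalIntegrable (fun _ => (1 : ℝ)) volume c d := intervalIntegrable_const
    ⟨h1.1.indicator hSm, h1.2.indicator hSm⟩
  have hsum : (∫ x in a..b, f x) =
      ∑ j ∈ Finset.range N, ∫ x in (a + h * j)..(a + h * (j + 1 : ℕ)), f x := by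
    rw [intervalIntegral.sum_integral_adjacent_intervals (a := fun j : ℕ => a + h * j)
      (fun k _ => hint _ _)]
    congr 1
    · simp
    · rw [hh]; field_simp; ring
  have hcell : ∀ j : ℕ, |(∫ x in (a + h * j)..(a + h * (j + 1 : ℕ)), f x) - h * f (a + h * j)| ≤
      if bad j then h else 0 := by
    intro j
    have e : (∫ x in (a + h * j)..(a + h * (j + 1 : ℕ)), f x) - h * f (a + h * j) =
        ∫ x in (a + h * j)..(a + h * (j + 1 : ℕ)), (f x - f (a + h * j)) := by
      rw [intervalIntegral.integral_sub (hint _ _) intervalIntegrable_const]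
      simp only [intervalIntegral.integral_const, smul_eq_mul]
      push_cast; ring
    have hle : a + h * j ≤ a + h * (j + 1 : ℕ) := by push_cast; nlinarith
    have hlen : |a + h * (j + 1 : ℕ) - (a + h * j)| = h := by
      rw [abs_of_nonneg (by linarith)]; push_cast; ring
    rw [e, ← Real.norm_eq_abs]
    split_ifs with hb
    · refine (intervalIntegral.norm_integral_le_of_norm_le_const (C := 1) ?_).trans ?_
      · intro x _
        simp only [hf, indicator, Real.norm_eq_abs]
        split_ifs <;> simp
      · rw [hlen, one_mul]
    · refine (intervalIntegral.norm_integral_le_of_norm_le_const (C := 0) ?_).trans (by simp)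
      intro x hx
      rw [uIoc_of_le hle] at hx
      push_cast at hx
      have hx' : x ∈ Icc (a + h * j) (a + h * (j + 1)) := ⟨hx.1.le, hx.2⟩
      have h0 : a + h * j ∈ Icc (a + h * (j : ℝ)) (a + h * (j + 1)) := ⟨le_rfl, by nlinarith⟩
      have hiff : x ∈ S ↔ a + h * j ∈ S := by
        simp only [hSC, mem_iUnion]
        exact exists_congr fun i =>
          ⟨fun hi => by_contra fun hn => hb ⟨i, ⟨x, hx', hi⟩, ⟨_, h0, hn⟩⟩,
            fun hi => by_contra fun hn => hb ⟨i, ⟨_, h0, hi⟩, ⟨x, hx', hn⟩⟩⟩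
      simp only [hf, indicator, hiff, sub_self, norm_zero, le_refl]
  have hcard : ((Finset.range N).filter bad).card ≤ 2 * M := by
    have hsub : (Finset.range N).filter bad ⊆ (Finset.univ : Finset (Fin M)).biUnion fun i =>
        (Finset.range N).filter fun j : ℕ => (∃ x ∈ Icc (a + h * j) (a + h * (j + 1)), x ∈ C i) ∧
          ∃ x ∈ Icc (a + h * j) (a + h * (j + 1)), x ∉ C i := by
      intro j hj
      simp only [hbad, Finset.mem_filter, Finset.mem_biUnion, Finset.mem_univ, true_and] at hj ⊢
      exact hj.2.imp fun i hi => ⟨hj.1, hi⟩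
    refine (Finset.card_le_card hsub).trans (Finset.card_biUnion_le.trans ?_)
    refine (Finset.sum_le_sum fun i _ => card_mixed_cells_le_two (hC i) a hh0 N).trans ?_
    simp [mul_comm]
  have hre : (b - a) / N * ∑ j : Fin N, f (a + (b - a) * (j : ℕ) / N) =
      ∑ j ∈ Finset.range N, h * f (a + h * j) := by
    rw [← Finset.mul_sum, ← Fin.sum_univ_eq_sum_range fun j => f (a + h * j)]
    refine congrArg _ (Finset.sum_congr rfl fun j _ => ?_)
    rw [hh, div_mul_eq_mul_div]
  rw [hre, hsum, ← Finset.sum_sub_distrib]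
  calc _ ≤ ∑ j ∈ Finset.range N, if bad j then h else 0 :=
        (Finset.abs_sum_le_sum_abs _ _).trans (Finset.sum_le_sum fun j _ => hcell j)
    _ = ((Finset.range N).filter bad).card * h := by
        rw [← Finset.sum_filter, Finset.sum_const, nsmul_eq_mul]
    _ ≤ ((2 * M : ℕ) : ℝ) * h := by gcongr
    _ = _ := by rw [hh]; push_cast; ring

/-- The measure of a union of `M` convex sets inside a box is close to the fraction of the points
of an `N × ⋯ × N` grid that it contains.  By induction on the dimension: Fubini's theorem reduces
the step to one coordinate, since the sections of the set are again unions of `M` convex sets. -/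
theorem grid_approx {M N : ℕ} (hN : 0 < N) : ∀ {k : ℕ} {a b : Fin k → ℝ}, (∀ i, a i ≤ b i) →
    ∀ {S : Set (Fin k → ℝ)}, IsConvexUnion M S →
    |volume.real (S ∩ Icc a b) - (∏ i, (b i - a i)) * ((∑ j : Fin k → Fin N,
      S.indicator (fun _ => (1 : ℝ)) fun i => a i + (b i - a i) * (j i : ℕ) / N) / N ^ k)|
      ≤ (∏ i, (b i - a i)) * (k * (2 * M / N)) := by
  have hN' : (0 : ℝ) < N := by exact_mod_cast hN
  classical
  intro k
  induction k with
  | zero =>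
    intro a b _ S _
    have hI : Icc a b = univ := by
      ext x; simp [Subsingleton.elim x a, Subsingleton.elim b a]
    by_cases hS : (fun i : Fin 0 => a i + (b i - a i) * ((i.elim0 : Fin N) : ℕ) / N) ∈ S
    · have : S = univ := eq_univ_of_forall fun x => (Subsingleton.elim _ x) ▸ hS
      simp [this, hI, measureReal_def, volume_pi]
    · have : S = ∅ := eq_empty_of_forall_notMem fun x => (Subsingleton.elim _ x) ▸ hS
      simp [this]
  | succ k ih =>
    intro a b hab S hS
    set a' : Fin k → ℝ := fun i => a i.succ with ha'
    set b' : Fin k → ℝ := fun i => b i.succ with hb'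
    have hab' : ∀ i, a' i ≤ b' i := fun i => hab _
    set V : ℝ := ∏ i, (b' i - a' i) with hV
    have hV0 : 0 ≤ V := Finset.prod_nonneg fun i _ => by linarith [hab' i]
    set δ : ℝ := b 0 - a 0 with hδ
    have hδ0 : 0 ≤ δ := by linarith [hab 0]
    have hcons : ∀ (t s : ℝ) (x y : Fin k → ℝ) (c d : ℝ),
        (Fin.cons (c * t + d * s) (c • x + d • y) : Fin (k + 1) → ℝ) =
          c • (Fin.cons t x : Fin (k + 1) → ℝ) + d • (Fin.cons s y : Fin (k + 1) → ℝ) := by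
      intro t s x y c d
      ext i
      refine Fin.cases ?_ (fun i => ?_) i <;> simp
    have hsec1 : ∀ x : Fin k → ℝ, IsConvexUnion M {t : ℝ | (Fin.cons t x : Fin (k + 1) → ℝ) ∈ S} :=
      fun x => hS.preimage (fun t : ℝ => (Fin.cons t x : Fin (k + 1) → ℝ)) fun s t c d hcd => by
        rw [← hcons, ← add_smul, hcd, one_smul]; rfl
    have hsec2 : ∀ t : ℝ, IsConvexUnion M {x | (Fin.cons t x : Fin (k + 1) → ℝ) ∈ S} :=
      fun t => hS.preimage (fun x => (Fin.cons t x : Fin (k + 1) → ℝ)) fun x y c d hcd => by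
        rw [← hcons, ← add_mul, hcd, one_mul]
    set p : ℕ → ℝ := fun j => a 0 + (b 0 - a 0) * j / N with hp
    -- the measure as an iterated integral
    let e := MeasurableEquiv.piFinSuccAbove (fun _ : Fin (k + 1) => ℝ) 0
    have he : MeasurePreserving e.symm :=
      (volume_preserving_piFinSuccAbove (fun _ : Fin (k + 1) => ℝ) 0).symm
    have hesymm : ∀ (t : ℝ) (x : Fin k → ℝ), e.symm (t, x) = Fin.cons t x := fun t x => by
      ext i
      exact Fin.cases rfl (fun _ => rfl) i
    set D : Set (ℝ × (Fin k → ℝ)) := e.symm ⁻¹' (S ∩ Icc a b) with hD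
    have hDmem : ∀ t x, (t, x) ∈ D ↔ (Fin.cons t x : Fin (k + 1) → ℝ) ∈ S ∧ t ∈ Icc (a 0) (b 0) ∧
        x ∈ Icc a' b' := by
      intro t x
      simp only [hD, mem_preimage, hesymm, mem_inter_iff, mem_Icc, Pi.le_def, Fin.forall_fin_succ,
        Fin.cons_zero, Fin.cons_succ, ha', hb']
      tauto
    have hSn : NullMeasurableSet (S ∩ Icc a b) volume :=
      (hS.nullMeasurableSet volume).inter measurableSet_Icc.nullMeasurableSet
    have hDn : NullMeasurableSet D volume := hSn.preimage he.quasiMeasurePreserving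
    have hDvol : volume D = volume (S ∩ Icc a b) := he.measure_preimage hSn
    have hDfin : volume D ≠ ⊤ := by
      rw [hDvol]
      exact ((measure_mono inter_subset_right).trans_lt isCompact_Icc.measure_lt_top).ne
    have hDint : Integrable (D.indicator fun _ => (1 : ℝ))
        ((volume : Measure ℝ).prod (volume : Measure (Fin k → ℝ))) :=
      (integrableOn_const hDfin).integrable_indicator₀ hDn
    have hvol : volume.real (S ∩ Icc a b) =
        ∫ x : Fin k → ℝ, ∫ t : ℝ, D.indicator (fun _ => (1 : ℝ)) (t, x) := by
      rw [← integral_prod_symm _ hDint, measureReal_def, ← hDvol]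
      change _ = ∫ z, D.indicator (fun _ => (1 : ℝ)) z ∂volume
      rw [integral_indicator₀ hDn]
      simp [measureReal_def]
    have hinner : ∀ x, (∫ t : ℝ, D.indicator (fun _ => (1 : ℝ)) (t, x)) =
        (Icc a' b').indicator (fun x => ∫ t in (a 0)..(b 0),
          {t : ℝ | (Fin.cons t x : Fin (k + 1) → ℝ) ∈ S}.indicator (fun _ => (1 : ℝ)) t) x := by
      intro x
      by_cases hx : x ∈ Icc a' b'
      · rw [indicator_of_mem hx, intervalIntegral.integral_of_le (hab 0),
          ← integral_Icc_eq_integral_Ioc, ← integral_indicator measurableSet_Icc]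
        refine integral_congr_ae (Filter.Eventually.of_forall fun t => ?_)
        simp only [indicator_apply, hDmem, hx, and_true, mem_ofPred_eq]
        by_cases h1 : t ∈ Icc (a 0) (b 0) <;> simp [h1]
      · rw [indicator_of_notMem hx]
        simp [hDmem, hx]
    -- the integral of the average over the first coordinate
    set avg : (Fin k → ℝ) → ℝ := fun x => δ / N * ∑ j : Fin N,
      ({x | (Fin.cons (p j) x : Fin (k + 1) → ℝ) ∈ S} ∩ Icc a' b').indicator
        (fun _ => (1 : ℝ)) x with havg
    have hslice : ∀ t : ℝ, NullMeasurableSet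
        ({x | (Fin.cons t x : Fin (k + 1) → ℝ) ∈ S} ∩ Icc a' b') volume := fun t =>
      ((hsec2 t).nullMeasurableSet volume).inter measurableSet_Icc.nullMeasurableSet
    have hslice_int : ∀ t : ℝ, Integrable
        (({x | (Fin.cons t x : Fin (k + 1) → ℝ) ∈ S} ∩ Icc a' b').indicator
          (fun _ => (1 : ℝ))) volume := fun t =>
      (integrableOn_const ((measure_mono inter_subset_right).trans_lt
        isCompact_Icc.measure_lt_top).ne).integrable_indicator₀ (hslice t)
    have havg_int : Integrable avg volume :=
      (integrable_finsetSum _ fun j _ => hslice_int _).const_mul _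
    have havg_eq : ∫ x, avg x = δ / N * ∑ j : Fin N,
        volume.real ({x | (Fin.cons (p j) x : Fin (k + 1) → ℝ) ∈ S} ∩ Icc a' b') := by
      rw [havg, integral_const_mul, integral_finsetSum _ fun j _ => hslice_int _]
      refine congrArg _ (Finset.sum_congr rfl fun j _ => ?_)
      rw [integral_indicator₀ (hslice _)]
      simp
    have hboxvol : volume.real (Icc a' b') = V := by
      rw [measureReal_def, Real.volume_Icc_pi_toReal (fun i => hab' i)]
    have hstep1 : |volume.real (S ∩ Icc a b) - ∫ x, avg x| ≤ δ * (2 * M / N) * V := by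
      rw [hvol, ← integral_sub hDint.integral_prod_right havg_int]
      calc _ ≤ ∫ x, |(∫ t : ℝ, D.indicator (fun _ => (1 : ℝ)) (t, x)) - avg x| :=
            abs_integral_le_integral_abs
        _ ≤ ∫ x, (Icc a' b').indicator (fun _ => δ * (2 * M / N)) x := by
            refine integral_mono (hDint.integral_prod_right.sub havg_int).abs
              ((integrable_indicator_iff measurableSet_Icc).2
                (integrableOn_const isCompact_Icc.measure_lt_top.ne)) fun x => ?_
            simp only [hinner, havg]
            by_cases hx : x ∈ Icc a' b'
            · have := grid_approx_one hN (hab 0) (hsec1 x)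
              simp only [indicator_of_mem hx]
              simpa only [indicator_apply, mem_inter_iff, hx, and_true, mem_ofPred_eq, hp] using this
            · simp [indicator_apply, hx]
        _ = _ := by
            rw [integral_indicator measurableSet_Icc]
            simp [hboxvol, mul_comm]
    -- the induction hypothesis for each slice
    set A : ℕ → ℝ := fun j' => (∑ j : Fin k → Fin N,
      {x | (Fin.cons (p j') x : Fin (k + 1) → ℝ) ∈ S}.indicator (fun _ => (1 : ℝ))
        fun i => a' i + (b' i - a' i) * (j i : ℕ) / N) / N ^ k with hA
    have hstep2 : |(∫ x, avg x) - δ / N * ∑ j : Fin N, V * A j| ≤ δ * V * (k * (2 * M / N)) := by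
      rw [havg_eq, ← mul_sub, ← Finset.sum_sub_distrib, abs_mul,
        abs_of_nonneg (div_nonneg hδ0 hN'.le)]
      calc _ ≤ δ / N * ∑ j : Fin N, V * (k * (2 * M / N)) := by
            gcongr
            refine (Finset.abs_sum_le_sum_abs _ _).trans (Finset.sum_le_sum fun j _ => ?_)
            exact ih hab' (hsec2 (p j))
        _ = _ := by simp; field_simp
    have hgrid : (∏ i, (b i - a i)) * ((∑ j : Fin (k + 1) → Fin N,
        S.indicator (fun _ => (1 : ℝ)) fun i => a i + (b i - a i) * (j i : ℕ) / N) / N ^ (k + 1)) =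
        δ / N * ∑ j : Fin N, V * A j := by
      rw [Fin.prod_univ_succ, ← Equiv.sum_comp (Fin.consEquiv fun _ => Fin N),
        Fintype.sum_prod_type, ← Finset.mul_sum, hA, ← Finset.sum_div]
      have : ∀ (x : Fin N) (y : Fin k → Fin N),
          (S.indicator (fun _ => (1 : ℝ)) fun i => a i + (b i - a i) *
            ((Fin.consEquiv (fun _ => Fin N) (x, y) i : Fin N) : ℕ) / N) =
          {z | (Fin.cons (p x) z : Fin (k + 1) → ℝ) ∈ S}.indicator (fun _ => (1 : ℝ))
            fun i => a' i + (b' i - a' i) * (y i : ℕ) / N := by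
        intro x y
        have h : (fun i => a i + (b i - a i) *
            ((Fin.consEquiv (fun _ => Fin N) (x, y) i : Fin N) : ℕ) / N) =
            (Fin.cons (p x) fun i => a' i + (b' i - a' i) * (y i : ℕ) / N : Fin (k + 1) → ℝ) := by
          ext i
          refine Fin.cases ?_ (fun i => ?_) i <;> simp [Fin.consEquiv, hp, ha', hb']
        rw [h]; rfl
      simp only [this]
      rw [pow_succ, ← hδ, ← hV]
      ring
    have hprod : ∏ i, (b i - a i) = δ * V := Fin.prod_univ_succ _
    rw [hgrid, hprod]
    calc _ ≤ _ := abs_sub_le _ (∫ x, avg x) _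
      _ ≤ δ * (2 * M / N) * V + δ * V * (k * (2 * M / N)) := add_le_add hstep1 hstep2
      _ = _ := by push_cast; ring

/-! ### The models form a union of few convex sets -/

/-- The number of comparisons in a quantifier-free formula. -/
def QF.atoms {τ : Type} : QF τ → ℕ
  | .le _ _ => 1
  | .lt _ _ => 1
  | .eq _ _ => 1
  | .not φ => φ.atoms
  | .and φ ψ => φ.atoms + ψ.atoms
  | .or φ ψ => φ.atoms + ψ.atoms

/-- The sign patterns of the comparisons partition the space into convex sets, and a
quantifier-free formula is decided by the pattern. -/
theorem QF.exists_convex_cover {τ E : Type} [AddCommGroup E] [Module ℝ E] (v : τ → E → ℝ)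
    (hv : ∀ s x y, ∀ a b : ℝ, a + b = 1 → v s (a • x + b • y) = a * v s x + b * v s y)
    (φ : QF τ) : ∃ (ι : Type) (_ : Fintype ι) (C : ι → Set E), Fintype.card ι = 3 ^ φ.atoms ∧
      (∀ i, Convex ℝ (C i)) ∧ (⋃ i, C i = univ) ∧
      ∀ i, (∀ x ∈ C i, φ.Holds fun s => v s x) ∨ ∀ x ∈ C i, ¬ φ.Holds fun s => v s x := by
  -- the three convex sets that belong to one comparison
  have base : ∀ s t : τ, ∃ C : Fin 3 → Set E, (∀ i, Convex ℝ (C i)) ∧ (⋃ i, C i = univ) ∧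
      (∀ x ∈ C 0, v s x < v t x) ∧ (∀ x ∈ C 1, v s x = v t x) ∧ (∀ x ∈ C 2, v t x < v s x) := by
    intro s t
    refine ⟨![{x | v s x < v t x}, {x | v s x = v t x}, {x | v t x < v s x}], ?_, ?_, ?_, ?_, ?_⟩
    · intro i x hx y hy a b ha hb hab
      fin_cases i
      · simp only [Fin.zero_eta, Matrix.cons_val_zero, mem_ofPred_eq] at hx hy ⊢
        rw [hv s x y a b hab, hv t x y a b hab]
        rcases ha.eq_or_lt with rfl | ha
        · obtain rfl : b = 1 := by linarith
          linarith
        · nlinarith [mul_lt_mul_of_pos_left hx ha, mul_le_mul_of_nonneg_left hy.le hb]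
      · have hx' : v s x = v t x := hx
        have hy' : v s y = v t y := hy
        change v s _ = v t _
        rw [hv s x y a b hab, hv t x y a b hab, hx', hy']
      · simp only [Fin.reduceFinMk, Matrix.cons_val, mem_ofPred_eq] at hx hy ⊢
        rw [hv s x y a b hab, hv t x y a b hab]
        rcases ha.eq_or_lt with rfl | ha
        · obtain rfl : b = 1 := by linarith
          linarith
        · nlinarith [mul_lt_mul_of_pos_left hx ha, mul_le_mul_of_nonneg_left hy.le hb]
    · refine eq_univ_of_forall fun x => mem_iUnion.2 ?_
      rcases lt_trichotomy (v s x) (v t x) with h | h | h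
      exacts [⟨0, h⟩, ⟨1, h⟩, ⟨2, h⟩]
    all_goals exact fun x hx => hx
  induction φ with
  | le s t =>
    obtain ⟨C, hC, hU, h0, h1, h2⟩ := base s t
    refine ⟨Fin 3, inferInstance, C, by simp [QF.atoms], hC, hU, fun i => ?_⟩
    fin_cases i
    · exact .inl fun x hx => (h0 x hx).le
    · exact .inl fun x hx => (h1 x hx).le
    · exact .inr fun x hx => not_le.2 (h2 x hx)
  | lt s t =>
    obtain ⟨C, hC, hU, h0, h1, h2⟩ := base s t
    refine ⟨Fin 3, inferInstance, C, by simp [QF.atoms], hC, hU, fun i => ?_⟩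
    fin_cases i
    · exact .inl fun x hx => h0 x hx
    · exact .inr fun x hx => (h1 x hx).not_lt
    · exact .inr fun x hx => not_lt.2 (h2 x hx).le
  | eq s t =>
    obtain ⟨C, hC, hU, h0, h1, h2⟩ := base s t
    refine ⟨Fin 3, inferInstance, C, by simp [QF.atoms], hC, hU, fun i => ?_⟩
    fin_cases i
    · exact .inr fun x hx => (h0 x hx).ne
    · exact .inl fun x hx => h1 x hx
    · exact .inr fun x hx => (h2 x hx).ne'
  | not φ ih =>
    obtain ⟨ι, _, C, hcard, hC, hU, h⟩ := ih
    exact ⟨ι, inferInstance, C, hcard, hC, hU, fun i =>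
      (h i).symm.imp_right fun h x hx hn => hn (h x hx)⟩
  | and φ ψ ihφ ihψ =>
    obtain ⟨ι, _, C, hcard, hC, hU, h⟩ := ihφ
    obtain ⟨κ, _, D, hcard', hD, hU', h'⟩ := ihψ
    refine ⟨ι × κ, inferInstance, fun p => C p.1 ∩ D p.2,
      by rw [Fintype.card_prod, hcard, hcard', QF.atoms, pow_add],
      fun p => (hC _).inter (hD _), ?_, fun p => ?_⟩
    · rw [iUnion_prod', ← iUnion_inter_iUnion, hU, hU', univ_inter]
    · rcases h p.1 with h | h
      · rcases h' p.2 with h' | h'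
        · exact .inl fun x hx => ⟨h x hx.1, h' x hx.2⟩
        · exact .inr fun x hx hn => h' x hx.2 hn.2
      · exact .inr fun x hx hn => h x hx.1 hn.1
  | or φ ψ ihφ ihψ =>
    obtain ⟨ι, _, C, hcard, hC, hU, h⟩ := ihφ
    obtain ⟨κ, _, D, hcard', hD, hU', h'⟩ := ihψ
    refine ⟨ι × κ, inferInstance, fun p => C p.1 ∩ D p.2,
      by rw [Fintype.card_prod, hcard, hcard', QF.atoms, pow_add],
      fun p => (hC _).inter (hD _), ?_, fun p => ?_⟩
    · rw [iUnion_prod', ← iUnion_inter_iUnion, hU, hU', univ_inter]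
    · rcases h p.1 with h | h
      · exact .inl fun x hx => .inl (h x hx.1)
      · rcases h' p.2 with h' | h'
        · exact .inl fun x hx => .inr (h' x hx.2)
        · exact .inr fun x hx hn => hn.elim (h x hx.1) (h' x hx.2)

theorem LinTerm.eval_combo {κ : Type} (t : LinTerm κ) (x y : κ → ℝ) (a b : ℝ) (hab : a + b = 1) :
    t.eval (a • x + b • y) = a * t.eval x + b * t.eval y := by
  induction t with
  | var j => simp [LinTerm.eval]
  | const q => simp [LinTerm.eval, ← add_mul, hab]
  | add s t hs ht => simp only [LinTerm.eval, hs, ht]; ring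
  | smul q t ht => simp only [LinTerm.eval, ht]; ring

namespace RAFormula

/-- The points, inside or outside the box of domains, that satisfy the formula. -/
def solutions (φ : RAFormula) : Set (Fin φ.k → ℝ) :=
  {x | ∃ u : Fin φ.n → ℝ, φ.body.Holds (LinTerm.eval (Sum.elim x u))}

/-- Existential quantification is a projection, so it preserves unions of convex sets. -/
theorem isConvexUnion_solutions (φ : RAFormula) :
    IsConvexUnion (3 ^ φ.body.atoms) φ.solutions := by
  classical
  obtain ⟨ι, _, C, hcard, hC, hU, h⟩ := φ.body.exists_convex_cover
    (fun t (x : Fin φ.k ⊕ Fin φ.n → ℝ) => t.eval x) fun t x y a b => t.eval_combo x y a b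
  let e := Fintype.equivFinOfCardEq hcard
  let π : (Fin φ.k ⊕ Fin φ.n → ℝ) →ₗ[ℝ] (Fin φ.k → ℝ) := LinearMap.funLeft ℝ ℝ Sum.inl
  refine ⟨fun j => if ∀ x ∈ C (e.symm j), φ.body.Holds fun s => s.eval x then π '' C (e.symm j)
    else ∅, fun j => ?_, ?_⟩
  · dsimp only
    split_ifs
    · exact (hC _).linear_image π
    · exact convex_empty
  · ext x
    simp only [mem_iUnion]
    constructor
    · rintro ⟨u, hu⟩
      obtain ⟨i, hi⟩ := mem_iUnion.1 (hU ▸ mem_univ (Sum.elim x u) : Sum.elim x u ∈ ⋃ i, C i)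
      have hall := (h i).resolve_right fun hn => hn _ hi hu
      refine ⟨e i, ?_⟩
      rw [e.symm_apply_apply, if_pos hall]
      exact ⟨_, hi, by ext; simp [π, LinearMap.funLeft]⟩
    · rintro ⟨j, hj⟩
      split_ifs at hj with hall
      · obtain ⟨w, hw, rfl⟩ := hj
        refine ⟨w ∘ Sum.inr, ?_⟩
        have : Sum.elim (π w) (w ∘ Sum.inr) = w := by
          ext i; cases i <;> simp [π, LinearMap.funLeft]
        rw [this]
        exact hall w hw
      · exact hj.elim

theorem models_eq (φ : RAFormula) : φ.models =
    φ.solutions ∩ Icc (fun i => ((φ.lo i).val : ℝ)) (fun i => ((φ.hi i).val : ℝ)) := by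
  ext x
  simp only [models, solutions, mem_ofPred_eq, mem_inter_iff, mem_Icc, Pi.le_def, forall_and]
  tauto

theorem lo_le_hi_real (φ : RAFormula) (i : Fin φ.k) :
    ((φ.lo i).val : ℝ) ≤ ((φ.hi i).val : ℝ) := by exact_mod_cast φ.lo_le_hi i

theorem boxVolume_nonneg (φ : RAFormula) : 0 ≤ φ.boxVolume :=
  Finset.prod_nonneg fun i _ => sub_nonneg.2 (φ.lo_le_hi_real i)

theorem modelCount_nonneg (φ : RAFormula) : 0 ≤ φ.modelCount := ENNReal.toReal_nonneg

theorem modelCount_le_boxVolume (φ : RAFormula) : φ.modelCount ≤ φ.boxVolume := by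
  rw [modelCount, models_eq, boxVolume, ← Real.volume_Icc_pi_toReal φ.lo_le_hi_real]
  exact ENNReal.toReal_mono isCompact_Icc.measure_lt_top.ne (measure_mono inter_subset_right)

end RAFormula

/-! ### Coin tosses -/

/-- The expected value of a function of `T` fair coin tosses, listed in order. -/
noncomputable def coinAvg : ℕ → (List Bool → ℝ) → ℝ
  | 0, f => f []
  | T + 1, f => (coinAvg T (fun l => f (false :: l)) + coinAvg T fun l => f (true :: l)) / 2

theorem coinAvg_mono {T : ℕ} {f g : List Bool → ℝ} (h : ∀ l, l.length = T → f l ≤ g l) :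
    coinAvg T f ≤ coinAvg T g := by
  induction T generalizing f g with
  | zero => exact h [] rfl
  | succ T ih =>
    have h0 := ih (f := fun l => f (false :: l)) (g := fun l => g (false :: l))
      fun l hl => h _ (by simp [hl])
    have h1 := ih (f := fun l => f (true :: l)) (g := fun l => g (true :: l))
      fun l hl => h _ (by simp [hl])
    simp only [coinAvg]
    linarith

theorem coinAvg_congr {T : ℕ} {f g : List Bool → ℝ} (h : ∀ l, l.length = T → f l = g l) :
    coinAvg T f = coinAvg T g :=
  le_antisymm (coinAvg_mono fun l hl => (h l hl).le) (coinAvg_mono fun l hl => (h l hl).ge)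

theorem coinAvg_const (T : ℕ) (c : ℝ) : coinAvg T (fun _ => c) = c := by
  induction T with
  | zero => rfl
  | succ T ih => simp [coinAvg, ih]

theorem coinAvg_add (T : ℕ) (f g : List Bool → ℝ) :
    coinAvg T (fun l => f l + g l) = coinAvg T f + coinAvg T g := by
  induction T generalizing f g with
  | zero => rfl
  | succ T ih => simp only [coinAvg, ih]; ring

theorem coinAvg_mul_left (T : ℕ) (c : ℝ) (f : List Bool → ℝ) :
    coinAvg T (fun l => c * f l) = c * coinAvg T f := by
  induction T generalizing f with
  | zero => rfl
  | succ T ih => simp only [coinAvg, ih]; ring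

theorem coinAvg_append (S T : ℕ) (f : List Bool → ℝ) :
    coinAvg (S + T) f = coinAvg S fun l => coinAvg T fun l' => f (l ++ l') := by
  induction S generalizing f with
  | zero => simp [coinAvg]
  | succ S ih => rw [Nat.add_right_comm]; simp only [coinAvg, ih, List.cons_append]

/-- `coinAvg` is the average over the uniform distribution that `coinProb` uses. -/
theorem sum_ofFn_eq_coinAvg (T : ℕ) (f : List Bool → ℝ) :
    ∑ r : Fin T → Bool, f (List.ofFn r) = 2 ^ T * coinAvg T f := by
  induction T generalizing f with
  | zero => simp [coinAvg]
  | succ T ih =>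
    rw [← Equiv.sum_comp (Fin.consEquiv fun _ => Bool), Fintype.sum_prod_type, Fintype.sum_bool]
    have h : ∀ (b : Bool) (r : Fin T → Bool),
        List.ofFn (Fin.consEquiv (fun _ => Bool) (b, r)) = b :: List.ofFn r := fun b r => by
      rw [List.ofFn_succ]; rfl
    simp only [h, ih fun l => f (true :: l), ih fun l => f (false :: l), coinAvg]
    ring

theorem le_coinProb {T : ℕ} {c : ℝ} {E : (Fin T → Bool) → Prop} {P : List Bool → Prop}
    [DecidablePred P] (hE : ∀ r, P (List.ofFn r) → E r)
    (hP : c ≤ coinAvg T fun l => if P l then 1 else 0) : c ≤ coinProb T E := by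
  classical
  rw [coinProb, le_div_iff₀ (by positivity)]
  have h := sum_ofFn_eq_coinAvg T fun l => if P l then 1 else 0
  rw [Finset.sum_boole] at h
  calc c * 2 ^ T ≤ 2 ^ T * coinAvg T fun l => if P l then 1 else 0 := by
        rw [mul_comm]; gcongr
    _ ≤ Nat.card {r : Fin T → Bool // E r} := by
        rw [← h, Nat.card_eq_fintype_card, Fintype.card_subtype]
        exact_mod_cast Finset.card_le_card fun r hr => by
          simp only [Finset.mem_filter, Finset.mem_univ, true_and] at hr ⊢
          exact hE r hr

/-- The number with the binary digits `l`, the highest first, written below those of `j`. -/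
def bitsNat (j : ℕ) (l : List Bool) : ℕ := l.foldl (fun j b => 2 * j + b.toNat) j

theorem bitsNat_lt (j : ℕ) (l : List Bool) : bitsNat j l < (j + 1) * 2 ^ l.length := by
  induction l generalizing j with
  | nil => simp [bitsNat]
  | cons b l ih =>
    refine (ih (2 * j + b.toNat)).trans_le ?_
    rw [List.length_cons, pow_succ, mul_comm (2 ^ _) 2, ← mul_assoc]
    gcongr
    have := b.toNat_le
    omega

theorem coinAvg_bitsNat (L j : ℕ) (g : ℕ → ℝ) :
    coinAvg L (fun l => g (bitsNat j l)) =
      (∑ i ∈ Finset.range (2 ^ L), g (j * 2 ^ L + i)) / 2 ^ L := by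
  induction L generalizing j with
  | zero => simp [coinAvg, bitsNat]
  | succ L ih =>
    have h0 := ih (2 * j)
    have h1 := ih (2 * j + 1)
    simp only [bitsNat] at h0 h1
    simp only [coinAvg, bitsNat, List.foldl_cons, Bool.toNat_false, Bool.toNat_true, add_zero,
      h0, h1]
    rw [show 2 ^ (L + 1) = 2 ^ L + 2 ^ L by ring, Finset.sum_range_add]
    have e0 : ∀ i, (2 * j) * 2 ^ L + i = j * (2 ^ L + 2 ^ L) + i := fun i => by ring
    have e1 : ∀ i, (2 * j + 1) * 2 ^ L + i = j * (2 ^ L + 2 ^ L) + (2 ^ L + i) := fun i => by ring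
    simp only [e0, e1]
    rw [pow_succ]
    ring

/-! ### Chebyshev's inequality for repeated trials -/

/-- The number of successes in `m` trials, each of which consumes `q` coin tosses. -/
def hitCount (Z : List Bool → ℕ) (q : ℕ) : ℕ → List Bool → ℕ
  | 0, _ => 0
  | m + 1, l => Z (l.take q) + hitCount Z q m (l.drop q)

theorem coinAvg_hitCount_step (Z : List Bool → ℕ) (q m : ℕ) (f : ℝ → ℝ) :
    coinAvg ((m + 1) * q) (fun l => f (hitCount Z q (m + 1) l)) =
      coinAvg q fun l => coinAvg (m * q) fun l' => f (Z l + hitCount Z q m l') := by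
  rw [show (m + 1) * q = q + m * q by ring, coinAvg_append]
  refine coinAvg_congr fun l hl => coinAvg_congr fun l' _ => ?_
  rw [hitCount, List.take_left' hl, List.drop_left' hl]
  push_cast
  rfl

theorem coinAvg_hitCount (Z : List Bool → ℕ) (q m : ℕ) :
    coinAvg (m * q) (fun l => (hitCount Z q m l : ℝ)) = m * coinAvg q fun l => Z l := by
  induction m with
  | zero => simp [hitCount, coinAvg]
  | succ m ih =>
    rw [coinAvg_hitCount_step Z q m fun x => x]
    simp only [coinAvg_add, coinAvg_const, ih]
    push_cast; ring

theorem coinAvg_hitCount_variance (Z : List Bool → ℕ) (hZ : ∀ l, Z l ≤ 1) (q m : ℕ) {p : ℝ}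
    (hp : p = coinAvg q fun l => Z l) :
    coinAvg (m * q) (fun l => ((hitCount Z q m l : ℝ) - m * p) ^ 2) = m * (p * (1 - p)) := by
  induction m with
  | zero => simp [hitCount, coinAvg]
  | succ m ih =>
    rw [coinAvg_hitCount_step Z q m fun x => (x - (m + 1 : ℕ) * p) ^ 2]
    have hmean := coinAvg_hitCount Z q m
    rw [← hp] at hmean
    have h1 : ∀ l : List Bool, coinAvg (m * q) (fun l' =>
        ((Z l : ℝ) + hitCount Z q m l' - (m + 1 : ℕ) * p) ^ 2) =
        (1 - 2 * p) * Z l + (p ^ 2 + m * (p * (1 - p))) := by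
      intro l
      have hsq : (Z l : ℝ) ^ 2 = Z l := by
        rcases Nat.le_one_iff_eq_zero_or_eq_one.1 (hZ l) with h | h <;> simp [h]
      have h2 : ∀ l' : List Bool, ((Z l : ℝ) + hitCount Z q m l' - (m + 1 : ℕ) * p) ^ 2 =
          ((1 - 2 * p) * Z l + p ^ 2 - 2 * (Z l - p) * (m * p)) +
            (2 * (Z l - p) * hitCount Z q m l' + ((hitCount Z q m l' : ℝ) - m * p) ^ 2) := by
        intro l'
        push_cast
        linear_combination hsq
      simp only [h2, coinAvg_add, coinAvg_const, coinAvg_mul_left, hmean, ih]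
      ring
    simp only [h1, coinAvg_add, coinAvg_const, coinAvg_mul_left, ← hp]
    push_cast; ring

/-- Chebyshev's inequality: the variance of the number of successes is at most `m / 4`, so with
probability at least `3 / 4` the frequency of success is within `δ ≥ 1 / √m` of its mean.  The
coin tosses after the last trial are ignored. -/
theorem hitCount_concentration (Z : List Bool → ℕ) (hZ : ∀ l, Z l ≤ 1) (q m : ℕ) {p δ : ℝ}
    (hp : p = coinAvg q fun l => Z l) (hδ : 0 < δ) (hm : 1 ≤ m * δ ^ 2) (rest : ℕ)
    [DecidablePred fun l => |(hitCount Z q m l : ℝ) - m * p| ≤ m * δ] :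
    3 / 4 ≤ coinAvg (m * q + rest) fun l =>
      if |(hitCount Z q m (l.take (m * q)) : ℝ) - m * p| ≤ m * δ then 1 else 0 := by
  have hm0 : (0 : ℝ) < m := by
    rcases Nat.eq_zero_or_pos m with rfl | h
    · norm_num at hm
    · exact_mod_cast h
  rw [coinAvg_append]
  have h1 : ∀ l, l.length = m * q → coinAvg rest (fun l' =>
      if |(hitCount Z q m ((l ++ l').take (m * q)) : ℝ) - m * p| ≤ m * δ then (1 : ℝ) else 0) =
      if |(hitCount Z q m l : ℝ) - m * p| ≤ m * δ then 1 else 0 := by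
    intro l hl
    simp only [List.take_left' hl, coinAvg_const]
  rw [coinAvg_congr h1]
  have hc : 0 < (m * δ) ^ 2 := by positivity
  calc (3 : ℝ) / 4 ≤ 1 + -((m * δ) ^ 2)⁻¹ * (m * (p * (1 - p))) := by
        have h4 : p * (1 - p) ≤ 1 / 4 := by nlinarith [sq_nonneg (p - 1 / 2)]
        have : ((m * δ) ^ 2)⁻¹ * (m * (p * (1 - p))) ≤ 1 / 4 := by
          rw [inv_mul_le_iff₀ hc]
          nlinarith
        linarith
    _ = coinAvg (m * q) fun l =>
          1 + -((m * δ) ^ 2)⁻¹ * ((hitCount Z q m l : ℝ) - m * p) ^ 2 := by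
        rw [coinAvg_add, coinAvg_const, coinAvg_mul_left, coinAvg_hitCount_variance Z hZ q m hp]
    _ ≤ _ := by
        refine coinAvg_mono fun l _ => ?_
        split_ifs with h
        · have : 0 ≤ ((m * δ) ^ 2)⁻¹ * ((hitCount Z q m l : ℝ) - m * p) ^ 2 := by positivity
          linarith
        · have h2 : (m * δ) ^ 2 ≤ ((hitCount Z q m l : ℝ) - m * p) ^ 2 := by
            rw [← sq_abs ((hitCount Z q m l : ℝ) - m * p)]
            exact pow_le_pow_left₀ (by positivity) (not_le.1 h).le 2
          have : 1 ≤ ((m * δ) ^ 2)⁻¹ * ((hitCount Z q m l : ℝ) - m * p) ^ 2 := by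
            rw [le_inv_mul_iff₀ hc]; linarith
          linarith

/-! ### Unique readability of the encodings -/

theorem Val.ofList_injective : Function.Injective Val.ofList := by
  intro l
  induction l with
  | nil => intro l' h; cases l' <;> simp_all [Val.ofList]
  | cons v l ih =>
    intro l' h
    cases l' with
    | nil => simp [Val.ofList] at h
    | cons v' l' =>
      simp only [Val.ofList, Val.pair.injEq] at h
      rw [h.1, ih h.2]

theorem Frac.enc_injective : Function.Injective Frac.enc := by
  rintro ⟨a, b, hb⟩ ⟨c, d, hd⟩ h
  simp only [Frac.enc, Val.pair.injEq, Val.int.injEq, Nat.cast_inj] at h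
  obtain ⟨rfl, rfl⟩ := h
  rfl

theorem IntTerm.enc_injective {ι : Type} {e : ι → Val} (he : Function.Injective e) :
    Function.Injective (IntTerm.enc e) := by
  intro t
  induction t with
  | var i => rintro (_ | _ | _ | _) h <;> simp [IntTerm.enc, he.eq_iff] at h ⊢; exact h
  | const c => rintro (_ | _ | _ | _) h <;> simp [IntTerm.enc] at h ⊢; exact h
  | add s t hs ht =>
    rintro (_ | _ | _ | _) h <;> simp [IntTerm.enc] at h ⊢; exact ⟨hs h.1, ht h.2⟩
  | mul s t hs ht =>
    rintro (_ | _ | _ | _) h <;> simp [IntTerm.enc] at h ⊢; exact ⟨hs h.1, ht h.2⟩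

theorem MixTerm.enc_injective {ι κ : Type} {d : ι → Val} {e : κ → Val}
    (hd : Function.Injective d) (he : Function.Injective e) :
    Function.Injective (MixTerm.enc d e) := by
  intro t
  induction t with
  | var i => rintro (_ | _ | _ | _ | _) h <;> simp [MixTerm.enc, he.eq_iff] at h ⊢; exact h
  | const c =>
    rintro (_ | _ | _ | _ | _) h <;> simp [MixTerm.enc] at h ⊢; exact Frac.enc_injective h
  | add s t hs ht =>
    rintro (_ | _ | _ | _ | _) h <;> simp [MixTerm.enc] at h ⊢; exact ⟨hs h.1, ht h.2⟩
  | smul q t ht =>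
    rintro (_ | _ | _ | _ | _) h <;> simp [MixTerm.enc] at h ⊢
    exact ⟨Frac.enc_injective h.1, ht h.2⟩
  | ofInt t =>
    rintro (_ | _ | _ | _ | _) h <;> simp [MixTerm.enc] at h ⊢
    exact IntTerm.enc_injective hd h

theorem QF.enc_injective {τ : Type} {e : τ → Val} (he : Function.Injective e) :
    Function.Injective (QF.enc e) := by
  intro φ
  induction φ with
  | le s t => rintro (_ | _ | _ | _ | _ | _) h <;> simp [QF.enc, he.eq_iff] at h ⊢; exact h
  | lt s t => rintro (_ | _ | _ | _ | _ | _) h <;> simp [QF.enc, he.eq_iff] at h ⊢; exact h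
  | eq s t => rintro (_ | _ | _ | _ | _ | _) h <;> simp [QF.enc, he.eq_iff] at h ⊢; exact h
  | not φ ih => rintro (_ | _ | _ | _ | _ | _) h <;> simp [QF.enc] at h ⊢; exact ih h
  | and φ ψ hφ hψ =>
    rintro (_ | _ | _ | _ | _ | _) h <;> simp [QF.enc] at h ⊢; exact ⟨hφ h.1, hψ h.2⟩
  | or φ ψ hφ hψ =>
    rintro (_ | _ | _ | _ | _ | _) h <;> simp [QF.enc] at h ⊢; exact ⟨hφ h.1, hψ h.2⟩

theorem encIdx_injective (m : ℕ) : Function.Injective (encIdx (m := m)) := by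
  intro i j h
  simpa [encIdx, Fin.ext_iff] using h

theorem encVar_injective (k n : ℕ) : Function.Injective (encVar (k := k) (n := n)) := by
  rintro (i | i) (j | j) h <;> simp [encVar, (encIdx_injective _).eq_iff] at h ⊢ <;> exact h

theorem ofList_ofFn_length {m m' : ℕ} {f : Fin m → Val} {g : Fin m' → Val}
    (h : Val.ofList (List.ofFn f) = Val.ofList (List.ofFn g)) : m = m' := by
  simpa using congrArg List.length (Val.ofList_injective h)

theorem ofList_ofFn_inj {m : ℕ} {f g : Fin m → Val}
    (h : Val.ofList (List.ofFn f) = Val.ofList (List.ofFn g)) : f = g :=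
  List.ofFn_injective (Val.ofList_injective h)

theorem MixFormula.enc_injective : Function.Injective MixFormula.enc := by
  rintro ⟨m, k, n, zlo, zhi, lo, hi, body⟩ ⟨m', k', n', zlo', zhi', lo', hi', body'⟩ h
  simp only [MixFormula.enc, Val.pair.injEq] at h
  obtain ⟨h1, h2, h3, h4⟩ := h
  obtain rfl := ofList_ofFn_length h1
  obtain rfl := ofList_ofFn_length h2
  obtain rfl : n = n' := by simpa using congrArg List.length (Val.ofList_injective h3)
  have h1' := congrFun (ofList_ofFn_inj h1)
  have h2' := congrFun (ofList_ofFn_inj h2)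
  simp only [Val.pair.injEq, Val.int.injEq, Frac.enc_injective.eq_iff] at h1' h2'
  obtain rfl : zlo = zlo' := funext fun i => (h1' i).1
  obtain rfl : zhi = zhi' := funext fun i => (h1' i).2
  obtain rfl : lo = lo' := funext fun i => (h2' i).1
  obtain rfl : hi = hi' := funext fun i => (h2' i).2
  obtain rfl :=
    QF.enc_injective (MixTerm.enc_injective (encIdx_injective _) (encVar_injective _ _)) h4
  rfl

theorem mixSatOracle_enc (ψ : MixFormula) : mixSatOracle ψ.enc ↔ ψ.Sat :=
  ⟨fun ⟨_, h, hs⟩ => MixFormula.enc_injective h ▸ hs, fun h => ⟨ψ, rfl, h⟩⟩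

/-! ### Deciding membership of a rational point by one query -/

/-- A linear term as a term of the combined theory. -/
def LinTerm.toMix {ι κ : Type} : LinTerm κ → MixTerm ι κ
  | .var j => .var j
  | .const q => .const q
  | .add s t => .add s.toMix t.toMix
  | .smul q t => .smul q t.toMix

theorem LinTerm.enc_toMix {ι κ : Type} (d : ι → Val) (e : κ → Val) (t : LinTerm κ) :
    (t.toMix : MixTerm ι κ).enc d e = t.enc e := by
  induction t <;> simp_all [LinTerm.toMix, MixTerm.enc, LinTerm.enc]

theorem LinTerm.eval_toMix {ι κ : Type} (z : ι → ℤ) (x : κ → ℝ) (t : LinTerm κ) :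
    (t.toMix : MixTerm ι κ).eval z x = t.eval x := by
  induction t <;> simp_all [LinTerm.toMix, MixTerm.eval, LinTerm.eval]

/-- Rewrite the terms of a quantifier-free formula. -/
def QF.map {σ τ : Type} (f : σ → τ) : QF σ → QF τ
  | .le s t => .le (f s) (f t)
  | .lt s t => .lt (f s) (f t)
  | .eq s t => .eq (f s) (f t)
  | .not φ => .not (φ.map f)
  | .and φ ψ => .and (φ.map f) (ψ.map f)
  | .or φ ψ => .or (φ.map f) (ψ.map f)

theorem QF.enc_map {σ τ : Type} (f : σ → τ) (e : τ → Val) (φ : QF σ) :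
    (φ.map f).enc e = φ.enc fun s => e (f s) := by
  induction φ <;> simp_all [QF.map, QF.enc]

theorem QF.holds_map {σ τ : Type} (f : σ → τ) (v : τ → ℝ) (φ : QF σ) :
    (φ.map f).Holds v ↔ φ.Holds fun s => v (f s) := by
  induction φ <;> simp_all [QF.map, QF.Holds]

namespace RAFormula

/-- The formula with the domain of each free variable shrunk to the single point `x i`. -/
def atPoint (φ : RAFormula) (x : Fin φ.k → Frac) : MixFormula where
  m := 0
  k := φ.k
  n := φ.n
  zlo := Fin.elim0
  zhi := Fin.elim0
  lo := x
  hi := x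
  body := φ.body.map LinTerm.toMix

theorem atPoint_sat (φ : RAFormula) (x : Fin φ.k → Frac) :
    (φ.atPoint x).Sat ↔ (fun i => ((x i).val : ℝ)) ∈ φ.solutions := by
  have h : ∀ (z : Fin 0 → ℤ) (y : Fin φ.k → ℝ) (u : Fin φ.n → ℝ),
      (φ.body.map LinTerm.toMix).Holds (MixTerm.eval z (Sum.elim y u)) ↔
        φ.body.Holds (LinTerm.eval (Sum.elim y u)) := by
    intro z y u
    simp only [QF.holds_map, LinTerm.eval_toMix]
  constructor
  · rintro ⟨z, y, u, -, hy, hu⟩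
    obtain rfl : y = fun i => ((x i).val : ℝ) := funext fun i => le_antisymm (hy i).2 (hy i).1
    exact ⟨u, (h z _ u).1 hu⟩
  · rintro ⟨u, hu⟩
    exact ⟨Fin.elim0, _, u, fun i => i.elim0, fun i => ⟨le_rfl, le_rfl⟩, (h _ _ u).2 hu⟩

theorem atPoint_enc (φ : RAFormula) (x : Fin φ.k → Frac) :
    (φ.atPoint x).enc = .pair (.int 0)
      (.pair (Val.ofList (List.ofFn fun i => .pair (x i).enc (x i).enc)) φ.enc.snd) := by
  simp only [MixFormula.enc, atPoint, QF.enc_map, LinTerm.enc_toMix, enc, Val.snd]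
  rfl

theorem mixSatOracle_atPoint (φ : RAFormula) (x : Fin φ.k → Frac) :
    mixSatOracle (.pair (.int 0) (.pair
      (Val.ofList (List.ofFn fun i => .pair (x i).enc (x i).enc)) φ.enc.snd)) ↔
      (fun i => ((x i).val : ℝ)) ∈ φ.solutions := by
  rw [← atPoint_enc, mixSatOracle_enc, atPoint_sat]

end RAFormula

/-! ### Sizes of values and costs of expressions -/

namespace Val

theorem size_pair (a b : Val) : (pair a b).size = a.size + b.size + 1 := rfl

theorem one_le_size (v : Val) : 1 ≤ v.size := by cases v <;> simp [size]

theorem size_toInt_le (v : Val) : (int v.toInt).size ≤ v.size := by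
  cases v with
  | int z => exact le_rfl
  | pair a b => simp [toInt, size]

theorem size_fst_le (v : Val) : v.fst.size ≤ v.size := by
  cases v <;> simp [fst, size]; omega

theorem size_snd_le (v : Val) : v.snd.size ≤ v.size := by
  cases v <;> simp [snd, size]; omega

theorem size_int_isPair_le (v : Val) : (int v.isPair).size ≤ 2 := by
  cases v <;> simp [isPair, size]

theorem size_int_le_of_lt {z : ℤ} {n : ℕ} (h : z.natAbs < 2 ^ n) : (int z).size ≤ n + 1 := by
  simpa [size] using Nat.size_le.2 h

theorem size_int_le (z : ℤ) : (int z).size ≤ z.natAbs + 1 :=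
  size_int_le_of_lt Nat.lt_two_pow_self

theorem size_natCast_le (n : ℕ) : (int n).size ≤ n + 1 := size_int_le n

theorem size_two_pow (n : ℕ) : (int (2 ^ n)).size = n + 2 := by
  simp [size, Int.natAbs_pow, Nat.size_pow]

theorem size_mono {x y : ℤ} (h : x.natAbs ≤ y.natAbs) : (int x).size ≤ (int y).size := by
  simpa [size] using Nat.size_le_size h

theorem natAbs_lt (x : ℤ) : x.natAbs < 2 ^ ((int x).size - 1) := by
  simpa [size] using Nat.lt_size_self x.natAbs

theorem size_mul_le (x y : ℤ) : (int (x * y)).size ≤ (int x).size + (int y).size := by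
  have hx := one_le_size (int x)
  have hy := one_le_size (int y)
  refine (size_int_le_of_lt (n := ((int x).size - 1) + ((int y).size - 1)) ?_).trans (by omega)
  rw [Int.natAbs_mul, pow_add]
  exact Nat.mul_lt_mul'' (natAbs_lt x) (natAbs_lt y)

theorem size_add_le (x y : ℤ) : (int (x + y)).size ≤ (int x).size + (int y).size := by
  have hx := one_le_size (int x)
  have hy := one_le_size (int y)
  refine (size_int_le_of_lt (n := max ((int x).size - 1) ((int y).size - 1) + 1) ?_).trans
    (by omega)
  have h1 := (natAbs_lt x).trans_le (Nat.pow_le_pow_right two_pos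
    (le_max_left ((int x).size - 1) ((int y).size - 1)))
  have h2 := (natAbs_lt y).trans_le (Nat.pow_le_pow_right two_pos
    (le_max_right ((int x).size - 1) ((int y).size - 1)))
  have := Int.natAbs_add_le x y
  rw [pow_succ]
  omega

theorem size_neg (x : ℤ) : (int (-x)).size = (int x).size := by simp [size]

theorem size_sub_le (x y : ℤ) : (int (x - y)).size ≤ (int x).size + (int y).size := by
  rw [sub_eq_add_neg, ← size_neg y]
  exact size_add_le _ _

theorem size_fdiv_le (x y : ℤ) : (int (Int.fdiv x y)).size ≤ (int x).size := by
  refine size_mono ?_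
  rcases x with (_ | m) | m <;> rcases y with (_ | n) | n
  all_goals first
    | exact (Nat.div_le_self _ _)
    | exact Nat.succ_le_succ (Nat.div_le_self _ _)
    | exact Nat.zero_le _

theorem size_apply_le (o : ArithOp) (x y : ℤ) :
    (int (o.apply x y)).size ≤ (int x).size + (int y).size := by
  cases o with
  | add => exact size_add_le x y
  | sub => exact size_sub_le x y
  | mul => exact size_mul_le x y
  | div => exact (size_fdiv_le x y).trans (Nat.le_add_right _ _)
  | le =>
    have hx := one_le_size (int x)
    have hy := one_le_size (int y)
    refine le_trans (b := 2) ?_ (by omega)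
    simp only [ArithOp.apply]
    split_ifs <;> simp [size]

/-- The number of inner nodes of a value. -/
def pairs : Val → ℕ
  | int _ => 0
  | pair a b => a.pairs + b.pairs + 1

theorem two_mul_pairs_lt_size (v : Val) : 2 * v.pairs + 1 ≤ v.size := by
  induction v with
  | int z => simp [pairs, size]
  | pair a b ha hb => simp only [pairs, size]; omega

theorem pairs_le_size (v : Val) : v.pairs ≤ v.size := by
  have := v.two_mul_pairs_lt_size
  omega

end Val

namespace Expr

/-- A factor by which the size of an expression may exceed the sizes of the registers. -/
def growth : Expr → ℕ
  | reg _ => 1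
  | const z => z.natAbs + 1
  | pair e f => e.growth + f.growth + 1
  | fst e => e.growth
  | snd e => e.growth
  | isPair _ => 2
  | arith _ e f => e.growth + f.growth

/-- A factor by which the cost of an expression may exceed the square of the register sizes. -/
def weight : Expr → ℕ
  | reg _ => 1
  | const _ => 1
  | pair e f => e.weight + f.weight + 1
  | fst e => e.weight + 1
  | snd e => e.weight + 1
  | isPair e => e.weight + 1
  | arith _ e f => e.weight + f.weight + e.growth * f.growth

end Expr

/-- All registers hold values of size at most `W`. -/
def BoundedBy (W : ℕ) (σ : ℕ → Val) : Prop := ∀ i, (σ i).size ≤ W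

namespace BoundedBy

theorem one_le {W : ℕ} {σ : ℕ → Val} (h : BoundedBy W σ) : 1 ≤ W :=
  (Val.one_le_size _).trans (h 0)

theorem update {W : ℕ} {σ : ℕ → Val} (h : BoundedBy W σ) (i : ℕ) {v : Val} (hv : v.size ≤ W) :
    BoundedBy W (Function.update σ i v) := fun j => by
  rcases eq_or_ne j i with rfl | hj
  · simpa using hv
  · simpa [hj] using h j

theorem size_eval_le {W : ℕ} {σ : ℕ → Val} (h : BoundedBy W σ) (e : Expr) :
    (e.eval σ).size ≤ e.growth * W := by
  have hW := h.one_le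
  induction e with
  | reg i => simpa [Expr.eval, Expr.growth] using h i
  | const z =>
    exact (Val.size_int_le z).trans (Nat.le_mul_of_pos_right _ hW)
  | pair e f he hf => simp only [Expr.eval, Expr.growth, Val.size]; nlinarith
  | fst e he => exact (Val.size_fst_le _).trans he
  | snd e he => exact (Val.size_snd_le _).trans he
  | isPair e he =>
    exact (Val.size_int_isPair_le _).trans (by simp only [Expr.growth]; omega)
  | arith o e f he hf =>
    refine (Val.size_apply_le _ _ _).trans ?_
    have h1 := Val.size_toInt_le (e.eval σ)
    have h2 := Val.size_toInt_le (f.eval σ)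
    simp only [Expr.growth]
    nlinarith

theorem cost_le {W : ℕ} {σ : ℕ → Val} (h : BoundedBy W σ) (e : Expr) :
    e.cost σ ≤ e.weight * W ^ 2 := by
  have hW : 1 ≤ W ^ 2 := Nat.one_le_pow _ _ h.one_le
  induction e with
  | reg i => simpa [Expr.cost, Expr.weight] using hW
  | const z => simpa [Expr.cost, Expr.weight] using hW
  | pair e f he hf => simp only [Expr.cost, Expr.weight]; nlinarith
  | fst e he => simp only [Expr.cost, Expr.weight]; nlinarith
  | snd e he => simp only [Expr.cost, Expr.weight]; nlinarith
  | isPair e he => simp only [Expr.cost, Expr.weight]; nlinarith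
  | arith o e f he hf =>
    have h1 := (Val.size_toInt_le (e.eval σ)).trans (h.size_eval_le e)
    have h2 := (Val.size_toInt_le (f.eval σ)).trans (h.size_eval_le f)
    have h3 := Nat.mul_le_mul h1 h2
    have h4 : e.growth * W * (f.growth * W) = e.growth * f.growth * W ^ 2 := by ring
    simp only [Expr.cost, Expr.weight, add_mul]
    omega

end BoundedBy

/-! ### Runs with counted primitive steps -/

/-- The cost allowed for one primitive step when the registers are bounded by `W`.  The factor
exceeds the weight of every expression that is evaluated below. -/
def unitCost (W : ℕ) : ℕ := 128 * W ^ 2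

/-- The program `c` runs from `σ, r` to `σ', r'` at the cost of at most `n` primitive steps on
registers bounded by `W`. -/
def Reach (O : Val → Prop) (W : ℕ) (c : Prog) (σ : ℕ → Val) (r : List Bool) (n : ℕ)
    (σ' : ℕ → Val) (r' : List Bool) : Prop :=
  ∃ t ≤ n * unitCost W, Exec O c σ r t σ' r'

namespace Reach

variable {O : Val → Prop} {W : ℕ} {σ σ₁ σ₂ : ℕ → Val} {r r₁ r₂ : List Bool} {m n : ℕ}

theorem mono {c : Prog} (h : Reach O W c σ r m σ₁ r₁) (hmn : m ≤ n) :
    Reach O W c σ r n σ₁ r₁ := by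
  obtain ⟨t, ht, hE⟩ := h
  exact ⟨t, ht.trans (Nat.mul_le_mul_right _ hmn), hE⟩

theorem cost_add_one_le {e : Expr} (hσ : BoundedBy W σ) (he : e.weight < 128) :
    e.cost σ + 1 ≤ unitCost W := by
  have h1 := hσ.cost_le e
  have hW : 1 ≤ W ^ 2 := Nat.one_le_pow _ _ hσ.one_le
  have h2 : (e.weight + 1) * W ^ 2 ≤ 128 * W ^ 2 := Nat.mul_le_mul_right _ he
  rw [unitCost]
  linarith [add_mul e.weight 1 (W ^ 2)]

theorem assign {i : ℕ} {e : Expr} {v : Val} (hσ : BoundedBy W σ) (he : e.weight < 128)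
    (hv : e.eval σ = v) : Reach O W (.assign i e) σ r 1 (Function.update σ i v) r :=
  hv ▸ ⟨_, by simpa using cost_add_one_le hσ he, Exec.assign i e σ r⟩

theorem seq {c d : Prog} (h : Reach O W c σ r m σ₁ r₁) (h' : Reach O W d σ₁ r₁ n σ₂ r₂) :
    Reach O W (.seq c d) σ r (m + n) σ₂ r₂ := by
  obtain ⟨s, hs, hE⟩ := h
  obtain ⟨t, ht, hE'⟩ := h'
  exact ⟨s + t, by rw [add_mul]; omega, Exec.seq hE hE'⟩

theorem ite_true {e : Expr} {c d : Prog} (hσ : BoundedBy W σ) (he : e.weight < 128)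
    (hv : (e.eval σ).toInt ≠ 0) (h : Reach O W c σ r n σ₁ r₁) :
    Reach O W (.ite e c d) σ r (n + 1) σ₁ r₁ := by
  obtain ⟨t, ht, hE⟩ := h
  have := cost_add_one_le hσ he
  exact ⟨_, by rw [add_mul]; omega, Exec.ite_true hv hE⟩

theorem ite_false {e : Expr} {c d : Prog} (hσ : BoundedBy W σ) (he : e.weight < 128)
    (hv : (e.eval σ).toInt = 0) (h : Reach O W d σ r n σ₁ r₁) :
    Reach O W (.ite e c d) σ r (n + 1) σ₁ r₁ := by
  obtain ⟨t, ht, hE⟩ := h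
  have := cost_add_one_le hσ he
  exact ⟨_, by rw [add_mul]; omega, Exec.ite_false hv hE⟩

theorem while_true {e : Expr} {c : Prog} (hσ : BoundedBy W σ) (he : e.weight < 128)
    (hv : (e.eval σ).toInt ≠ 0) (h : Reach O W c σ r m σ₁ r₁)
    (h' : Reach O W (.while e c) σ₁ r₁ n σ₂ r₂) :
    Reach O W (.while e c) σ r (m + n + 1) σ₂ r₂ := by
  obtain ⟨s, hs, hE⟩ := h
  obtain ⟨t, ht, hE'⟩ := h'
  have := cost_add_one_le hσ he
  exact ⟨_, by rw [add_mul, add_mul]; omega, Exec.while_true hv hE hE'⟩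

theorem while_false {e : Expr} {c : Prog} (hσ : BoundedBy W σ) (he : e.weight < 128)
    (hv : (e.eval σ).toInt = 0) : Reach O W (.while e c) σ r 1 σ r :=
  ⟨_, by simpa using cost_add_one_le hσ he, Exec.while_false hv⟩

theorem flip {i : ℕ} {b : Bool} (hσ : BoundedBy W σ) :
    Reach O W (.flip i) σ (b :: r) 1 (Function.update σ i (.int b.toNat)) r := by
  have hW : 1 ≤ W ^ 2 := Nat.one_le_pow _ _ hσ.one_le
  refine ⟨1, by rw [unitCost]; omega, ?_⟩
  have : (b.toNat : ℤ) = if b then 1 else 0 := by cases b <;> rfl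
  rw [this]
  exact Exec.flip i σ b r

open Classical in
theorem query {i : ℕ} {e : Expr} {v : Val} (hσ : BoundedBy W σ)
    (he : e.weight + e.growth < 128) (hv : e.eval σ = v) :
    Reach O W (.query i e) σ r 1
      (Function.update σ i (.int (if O v then 1 else 0 : ℕ))) r := by
  subst hv
  have h1 := hσ.cost_le e
  have h2 := hσ.size_eval_le e
  have hW : 1 ≤ W ^ 2 := Nat.one_le_pow _ _ hσ.one_le
  have hWW : W ≤ W ^ 2 := Nat.le_self_pow two_ne_zero W
  have h3 : e.growth * W ≤ e.growth * W ^ 2 := Nat.mul_le_mul_left _ hWW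
  have h4 : (e.weight + e.growth + 1) * W ^ 2 ≤ 128 * W ^ 2 := Nat.mul_le_mul_right _ he
  have h5 : e.cost σ + (e.eval σ).size + 1 ≤ 1 * unitCost W := by
    rw [unitCost]
    linarith [add_mul (e.weight + e.growth) 1 (W ^ 2), add_mul e.weight e.growth (W ^ 2)]
  by_cases h : O (e.eval σ)
  · rw [if_pos h]; exact ⟨_, h5, Exec.query_yes h⟩
  · rw [if_neg h]; exact ⟨_, h5, Exec.query_no h⟩

end Reach

/-! ### Counting the inner nodes of a value -/

/-- Adds the number of inner nodes of the values on the stack in register `1` to register `2`. -/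
def countPairs : Prog :=
  .while (.isPair (.reg 1))
    (.ite (.isPair (.fst (.reg 1)))
      (.seq (.assign 1 (.pair (.fst (.fst (.reg 1)))
          (.pair (.snd (.fst (.reg 1))) (.snd (.reg 1)))))
        (.assign 2 (.arith .add (.reg 2) (.const 1))))
      (.assign 1 (.snd (.reg 1))))

/-- Each iteration removes at least one unit from the total size `n` of the stack. -/
theorem reach_countPairs {O : Val → Prop} {W : ℕ} (n : ℕ) :
    ∀ (l : List Val) (c : ℕ) (σ : ℕ → Val) (r : List Bool), (l.map Val.size).sum ≤ n →
    BoundedBy W σ → σ 1 = Val.ofList l → σ 2 = .int c → c + (l.map Val.pairs).sum + 1 ≤ W →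
    ∃ σ', Reach O W countPairs σ r (4 * n + 1) σ' r ∧ BoundedBy W σ' ∧
      σ' 2 = .int (c + (l.map Val.pairs).sum : ℕ) ∧ ∀ i, i ≠ 1 → i ≠ 2 → σ' i = σ i := by
  induction n with
  | zero =>
    intro l c σ r hl hσ h1 h2 _
    cases l with
    | cons v l =>
      have := v.one_le_size
      simp only [List.map_cons, List.sum_cons] at hl
      omega
    | nil =>
      refine ⟨σ, ?_, hσ, by simpa using h2, fun i _ _ => rfl⟩
      exact Reach.while_false hσ (by decide) (by simp [Expr.eval, h1, Val.ofList, Val.isPair,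
        Val.toInt])
  | succ n ih =>
    intro l c σ r hl hσ h1 h2 hW
    cases l with
    | nil =>
      refine ⟨σ, ?_, hσ, by simpa using h2, fun i _ _ => rfl⟩
      exact (Reach.while_false hσ (by decide) (by simp [Expr.eval, h1, Val.ofList, Val.isPair,
        Val.toInt])).mono (by omega)
    | cons v l =>
      have hg : ((Expr.isPair (.reg 1)).eval σ).toInt ≠ 0 := by
        simp [Expr.eval, h1, Val.ofList, Val.isPair, Val.toInt]
      have hs := hσ 1
      rw [h1] at hs
      cases v with
      | int z =>
        simp only [List.map_cons, List.sum_cons, Val.size, Val.pairs, zero_add] at hl hW ⊢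
        simp only [Val.ofList, Val.size] at hs
        have hb1 := hσ.update 1 (v := Val.ofList l) (by omega)
        obtain ⟨σ', hR, hb, h2', hf⟩ := ih l c (Function.update σ 1 (Val.ofList l)) r (by omega) hb1
          (by simp) (by simpa using h2) hW
        refine ⟨σ', ?_, hb, h2', fun i hi hi' => by rw [hf i hi hi']; simp [hi]⟩
        refine (Reach.while_true hσ (by decide) hg (Reach.ite_false hσ (by decide)
          (by simp [Expr.eval, h1, Val.ofList, Val.isPair, Val.fst, Val.toInt])
          (Reach.assign hσ (by decide) (by simp [Expr.eval, h1, Val.ofList, Val.snd]))) hR).mono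
          (by omega)
      | pair a b =>
        simp only [List.map_cons, List.sum_cons, Val.size, Val.pairs] at hl hW ⊢
        simp only [Val.ofList, Val.size] at hs
        have hb1 := hσ.update 1 (v := Val.ofList (a :: b :: l))
          (by simp only [Val.ofList, Val.size]; omega)
        have hb2 := hb1.update 2 (v := .int (c + 1 : ℕ))
          ((Val.size_natCast_le _).trans (by omega))
        obtain ⟨σ', hR, hb, h2', hf⟩ := ih (a :: b :: l) (c + 1) _ r
          (by simp only [List.map_cons, List.sum_cons]; omega) hb2 (by simp) (by simp)
          (by simp only [List.map_cons, List.sum_cons]; omega)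
        refine ⟨σ', ?_, hb, ?_, fun i hi hi' => by rw [hf i hi hi']; simp [hi, hi']⟩
        · refine (Reach.while_true hσ (by decide) hg (Reach.ite_true hσ (by decide)
            (by simp [Expr.eval, h1, Val.ofList, Val.isPair, Val.fst, Val.toInt])
            (Reach.seq (Reach.assign hσ (by decide)
              (by simp [Expr.eval, h1, Val.ofList, Val.fst, Val.snd]))
              (Reach.assign hb1 (by decide)
              (by simp [Expr.eval, h2, ArithOp.apply, Val.toInt])))) hR).mono (by omega)
        · rw [h2']
          simp only [List.map_cons, List.sum_cons]
          congr 2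
          omega

/-! ### Reversing the list of domains -/

/-- The encoding of the domain of a variable. -/
def boxVal (p : Frac × Frac) : Val := .pair p.1.enc p.2.enc

/-- The numerator of the length of a domain, over the denominator `boxDen`. -/
def boxNum (p : Frac × Frac) : ℤ := p.2.num * p.1.den - p.1.num * p.2.den

/-- A common denominator of the ends of a domain. -/
def boxDen (p : Frac × Frac) : ℕ := p.1.den * p.2.den

/-- The numerator of the lower end of the domain that `e` evaluates to. -/
abbrev loNum (e : Expr) : Expr := .fst (.fst e)

/-- The denominator of the lower end of the domain that `e` evaluates to. -/
abbrev loDen (e : Expr) : Expr := .snd (.fst e)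

/-- The numerator of the upper end of the domain that `e` evaluates to. -/
abbrev hiNum (e : Expr) : Expr := .fst (.snd e)

/-- The denominator of the upper end of the domain that `e` evaluates to. -/
abbrev hiDen (e : Expr) : Expr := .snd (.snd e)

/-- An expression for `boxNum`. -/
abbrev boxNumExpr (e : Expr) : Expr :=
  .arith .sub (.arith .mul (hiNum e) (loDen e)) (.arith .mul (loNum e) (hiDen e))

/-- An expression for `boxDen`. -/
abbrev boxDenExpr (e : Expr) : Expr := .arith .mul (loDen e) (hiDen e)

theorem size_boxNum_le (p : Frac × Frac) : (Val.int (boxNum p)).size + 3 ≤ (boxVal p).size := by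
  have h1 := Val.size_sub_le (p.2.num * p.1.den) (p.1.num * p.2.den)
  have h2 := Val.size_mul_le p.2.num p.1.den
  have h3 := Val.size_mul_le p.1.num p.2.den
  simp only [boxNum, boxVal, Frac.enc, Val.size] at *
  omega

theorem size_boxDen_le (p : Frac × Frac) : (Val.int (boxDen p)).size + 3 ≤ (boxVal p).size := by
  have h1 := Val.size_mul_le p.1.den p.2.den
  have h2 := (Val.int p.1.num).one_le_size
  simp only [boxDen, Nat.cast_mul, boxVal, Frac.enc, Val.size] at *
  omega

/-- Reverses the list of domains in register `9` into register `6`, and multiplies the registers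
`7` and `8` by the numerator and the denominator of the volume of the box. -/
def reverseBox : Prog :=
  .while (.isPair (.reg 9))
    (.seq (.assign 6 (.pair (.fst (.reg 9)) (.reg 6)))
    (.seq (.assign 7 (.arith .mul (.reg 7) (boxNumExpr (.fst (.reg 9)))))
    (.seq (.assign 8 (.arith .mul (.reg 8) (boxDenExpr (.fst (.reg 9)))))
    (.assign 9 (.snd (.reg 9))))))

theorem reach_reverseBox {O : Val → Prop} {W : ℕ} (l : List (Frac × Frac)) :
    ∀ (acc : List (Frac × Frac)) (x : ℤ) (y : ℕ) (σ : ℕ → Val) (r : List Bool),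
    BoundedBy W σ → σ 9 = Val.ofList (l.map boxVal) → σ 6 = Val.ofList (acc.map boxVal) →
    σ 7 = .int x → σ 8 = .int y → (σ 6).size + (σ 9).size ≤ W → (σ 7).size + (σ 9).size ≤ W →
    (σ 8).size + (σ 9).size ≤ W →
    ∃ σ', Reach O W reverseBox σ r (5 * l.length + 1) σ' r ∧ BoundedBy W σ' ∧
      σ' 6 = Val.ofList ((l.reverse ++ acc).map boxVal) ∧ σ' 7 = .int (x * (l.map boxNum).prod) ∧
      σ' 8 = .int (y * (l.map boxDen).prod : ℕ) ∧
      ∀ i, i ≠ 6 → i ≠ 7 → i ≠ 8 → i ≠ 9 → σ' i = σ i := by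
  induction l with
  | nil =>
    intro acc x y σ r hσ h9 h6 h7 h8 _ _ _
    refine ⟨σ, ?_, hσ, by simpa using h6, by simpa using h7, by simpa using h8, fun i _ _ _ _ => rfl⟩
    exact Reach.while_false hσ (by decide) (by simp [Expr.eval, h9, Val.ofList, Val.isPair,
      Val.toInt])
  | cons p l ih =>
    intro acc x y σ r hσ h9 h6 h7 h8 hw6 hw7 hw8
    have hn := size_boxNum_le p
    have hd := size_boxDen_le p
    have hx := Val.size_mul_le x (boxNum p)
    have hy := Val.size_mul_le y (boxDen p)
    rw [h9, h6, List.map_cons] at hw6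
    rw [h9, h7, List.map_cons] at hw7
    rw [h9, h8, List.map_cons] at hw8
    rw [List.map_cons] at h9
    simp only [Val.ofList, Val.size_pair] at hw6 hw7 hw8
    have b1 := hσ.update 6 (v := Val.ofList ((p :: acc).map boxVal))
      (by simp only [List.map_cons, Val.ofList, Val.size_pair]; omega)
    have b2 := b1.update 7 (v := .int (x * boxNum p)) (by omega)
    have b3 := b2.update 8 (v := .int (y * boxDen p : ℕ)) (by push_cast; omega)
    have b4 := b3.update 9 (v := Val.ofList (l.map boxVal)) (by omega)
    obtain ⟨σ', hR, hb, h6', h7', h8', hf⟩ := ih (p :: acc) (x * boxNum p) (y * boxDen p) _ r b4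
      (by simp) (by simp) (by simp) (by simp)
      (by simp [Val.ofList, Val.size_pair]; omega)
      (by simp; omega)
      (by simp; omega)
    refine ⟨σ', ?_, hb, ?_, ?_, ?_, fun i hi6 hi7 hi8 hi9 => ?_⟩
    · refine (Reach.while_true hσ (by decide)
        (by simp [Expr.eval, h9, Val.ofList, Val.isPair, Val.toInt])
        (Reach.seq (Reach.assign hσ (by decide)
          (by simp [Expr.eval, h9, h6, Val.ofList, Val.fst]))
        (Reach.seq (Reach.assign b1 (by decide)
          (by simp [Expr.eval, h9, h7, Val.ofList, Val.fst, Val.snd, boxVal, boxNum, Frac.enc,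
            Val.toInt, ArithOp.apply]))
        (Reach.seq (Reach.assign b2 (by decide)
          (by simp [Expr.eval, h9, h8, Val.ofList, Val.fst, Val.snd, boxVal, boxDen, Frac.enc,
            Val.toInt, ArithOp.apply]))
        (Reach.assign b3 (by decide) (by simp [Expr.eval, h9, Val.ofList, Val.snd]))))) hR).mono ?_
      simp only [List.length_cons]
      omega
    · rw [h6']; simp
    · rw [h7']; simp [mul_assoc]
    · rw [h8']; simp [mul_assoc]
    · rw [hf i hi6 hi7 hi8 hi9]; simp [hi6, hi7, hi8, hi9]

/-! ### Sampling a grid point -/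

/-- Appends as many random binary digits as register `16` says to the number in register `15`,
and doubles register `20` as many times. -/
def tossLoop : Prog :=
  .while (.reg 16)
    (.seq (.flip 17)
    (.seq (.assign 15 (.arith .add (.arith .mul (.const 2) (.reg 15)) (.reg 17)))
    (.seq (.assign 20 (.arith .mul (.const 2) (.reg 20)))
    (.assign 16 (.arith .sub (.reg 16) (.const 1))))))

theorem reach_tossLoop {O : Val → Prop} {W : ℕ} (bs : List Bool) :
    ∀ (j a : ℕ) (σ : ℕ → Val) (r : List Bool), BoundedBy W σ →
    σ 15 = .int j → σ 16 = .int bs.length → σ 20 = .int (2 ^ a) → j < 2 ^ a →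
    a + bs.length + 2 ≤ W →
    ∃ σ', Reach O W tossLoop σ (bs ++ r) (5 * bs.length + 1) σ' r ∧ BoundedBy W σ' ∧
      σ' 15 = .int (bitsNat j bs) ∧ σ' 20 = .int (2 ^ (a + bs.length)) ∧
      ∀ i, i ≠ 15 → i ≠ 16 → i ≠ 17 → i ≠ 20 → σ' i = σ i := by
  induction bs with
  | nil =>
    intro j a σ r hσ h15 h16 h20 _ _
    refine ⟨σ, ?_, hσ, by simpa [bitsNat] using h15, by simpa using h20, fun i _ _ _ _ => rfl⟩
    exact Reach.while_false hσ (by decide) (by simp [Expr.eval, h16, Val.toInt])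
  | cons b bs ih =>
    intro j a σ r hσ h15 h16 h20 hj hW
    rw [List.length_cons] at hW
    have hb : b.toNat ≤ 1 := b.toNat_le
    have hj' : 2 * j + b.toNat < 2 ^ (a + 1) := by rw [pow_succ]; omega
    have b1 := hσ.update 17 (v := .int b.toNat) ((Val.size_natCast_le _).trans (by omega))
    have b2 := b1.update 15 (v := .int (2 * j + b.toNat : ℕ))
      ((Val.size_int_le_of_lt (n := a + 1) (by rw [Int.natAbs_natCast]; exact hj')).trans (by omega))
    have b3 := b2.update 20 (v := .int (2 ^ (a + 1))) (by rw [Val.size_two_pow]; omega)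
    have b4 := b3.update 16 (v := .int bs.length) ((Val.size_natCast_le _).trans (by omega))
    obtain ⟨σ', hR, hB, h15', h20', hf⟩ := ih (2 * j + b.toNat) (a + 1) _ r b4
      (by simp) (by simp) (by simp) hj' (by omega)
    refine ⟨σ', ?_, hB, by simpa [bitsNat] using h15', ?_, fun i hi hi' hi'' hi''' => ?_⟩
    · refine (Reach.while_true hσ (by decide)
        (by simp only [Expr.eval, h16, Val.toInt, List.length_cons]; omega)
        (Reach.seq (Reach.flip hσ) (Reach.seq (Reach.assign b1 (by decide)
          (by simp [Expr.eval, h15, Val.toInt, ArithOp.apply]))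
        (Reach.seq (Reach.assign b2 (by decide)
          (by simp [Expr.eval, h20, Val.toInt, ArithOp.apply, pow_succ, mul_comm]))
        (Reach.assign b3 (by decide)
          (by simp [Expr.eval, h16, Val.toInt, ArithOp.apply]))))) hR).mono ?_
      simp only [List.length_cons]
      omega
    · rw [h20', List.length_cons, add_assoc, add_comm 1]
    · rw [hf i hi hi' hi'' hi''']; simp [hi, hi', hi'', hi''']

/-- The grid point number `j` of `2 ^ L` in a domain. -/
def gridPoint (L : ℕ) (p : Frac × Frac) (j : ℕ) : Frac where
  num := p.1.num * p.2.den * 2 ^ L + boxNum p * j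
  den := boxDen p * 2 ^ L
  den_pos := Nat.mul_pos (Nat.mul_pos p.1.den_pos p.2.den_pos) (by positivity)

/-- The random grid point of a box, given by the reversed list of its domains; coordinates are
pushed onto `acc`. -/
def gridSample (L : ℕ) : List (Frac × Frac) → List Bool → List Frac → List Frac
  | [], _, acc => acc
  | p :: l, bs, acc => gridSample L l (bs.drop L) (gridPoint L p (bitsNat 0 (bs.take L)) :: acc)

/-- The encoding of a one-point domain. -/
def pointVal (x : Frac) : Val := .pair x.enc x.enc

theorem size_gridPoint_le {L : ℕ} (p : Frac × Frac) {j : ℕ} (hj : j < 2 ^ L) :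
    (gridPoint L p j).enc.size ≤ 3 * (boxVal p).size + 3 * L + 6 := by
  have h1 := Val.size_add_le (p.1.num * p.2.den * 2 ^ L) (boxNum p * j)
  have h2 := Val.size_mul_le (p.1.num * p.2.den) (2 ^ L)
  have h3 := Val.size_mul_le p.1.num p.2.den
  have h4 := Val.size_mul_le (boxNum p) j
  have h5 := size_boxNum_le p
  have h6 := size_boxDen_le p
  have h7 := Val.size_mul_le (boxDen p) (2 ^ L)
  have h8 : (Val.int j).size ≤ L + 1 := Val.size_int_le_of_lt (by simpa using hj)
  have h9 := Val.size_two_pow L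
  have h10 : (Val.int p.1.num).size + (Val.int p.2.den).size + 3 ≤ (boxVal p).size := by
    have e1 := (Val.int p.1.den).one_le_size
    have e2 := (Val.int p.2.num).one_le_size
    simp only [boxVal, Frac.enc, Val.size_pair]
    omega
  simp only [gridPoint, Frac.enc, Val.size_pair]
  push_cast
  omega

/-- Samples one coordinate and pushes its one-point domain onto the list in register `13`. -/
def sampleCoord : Prog :=
  .seq (.assign 15 (.const 0))
  (.seq (.assign 16 (.reg 4))
  (.seq (.assign 20 (.const 1))
  (.seq tossLoop
  (.seq (.assign 18 (.pair
    (.arith .add (.arith .mul (.arith .mul (loNum (.fst (.reg 14))) (hiDen (.fst (.reg 14))))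
        (.reg 20))
      (.arith .mul (boxNumExpr (.fst (.reg 14))) (.reg 15)))
    (.arith .mul (boxDenExpr (.fst (.reg 14))) (.reg 20))))
  (.seq (.assign 13 (.pair (.pair (.reg 18) (.reg 18)) (.reg 13)))
  (.assign 14 (.snd (.reg 14))))))))

/-- Samples a grid point of the box whose reversed list of domains is in register `14`. -/
def samplePoint : Prog := .while (.isPair (.reg 14)) sampleCoord

/-- Each coordinate adds at most `B` to the size of the list in register `13`. -/
theorem reach_samplePoint {O : Val → Prop} {W L B : ℕ} (l : List (Frac × Frac)) :
    ∀ (acc : List Frac) (bs : List Bool) (σ : ℕ → Val) (r : List Bool), BoundedBy W σ →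
    bs.length = l.length * L → σ 4 = .int L → σ 14 = Val.ofList (l.map boxVal) →
    σ 13 = Val.ofList (acc.map pointVal) → L + 2 ≤ W → B ≤ W →
    6 * (σ 14).size + 6 * L + 14 ≤ B → (σ 13).size + l.length * B ≤ W →
    ∃ σ', Reach O W samplePoint σ (bs ++ r) (l.length * (5 * L + 8) + 1) σ' r ∧ BoundedBy W σ' ∧
      σ' 13 = Val.ofList ((gridSample L l bs acc).map pointVal) ∧
      ∀ i, i < 13 → σ' i = σ i := by
  induction l with
  | nil =>
    intro acc bs σ r hσ hbs h4 h14 h13 hL hBW hB hW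
    obtain rfl : bs = [] := by simpa using hbs
    refine ⟨σ, ?_, hσ, h13, fun i _ => rfl⟩
    exact (Reach.while_false hσ (by decide) (by simp [Expr.eval, h14, Val.ofList, Val.isPair,
      Val.toInt])).mono (by omega)
  | cons p l ih =>
    intro acc bs σ r hσ hbs h4 h14 h13 hL hBW hB hW
    rw [List.length_cons, add_mul, one_mul] at hbs hW
    have htake : (bs.take L).length = L := by rw [List.length_take]; omega
    have hdrop : (bs.drop L).length = l.length * L := by rw [List.length_drop]; omega
    set j := bitsNat 0 (bs.take L) with hj
    have hjlt : j < 2 ^ L := by simpa [htake] using bitsNat_lt 0 (bs.take L)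
    have hsz := size_gridPoint_le p hjlt
    rw [h14, List.map_cons, Val.ofList, Val.size_pair] at hB
    have b1 := hσ.update 15 (v := .int (0 : ℕ)) ((Val.size_natCast_le _).trans (by omega))
    have b2 := b1.update 16 (v := .int L) ((Val.size_natCast_le _).trans (by omega))
    have b3 := b2.update 20 (v := .int (2 ^ 0)) (by rw [Val.size_two_pow]; omega)
    obtain ⟨τ, hR1, b4, t15, t20, tf⟩ := reach_tossLoop (O := O) (bs.take L) 0 0 _
      (bs.drop L ++ r) b3 (by simp) (by simp [htake]) (by simp) (by simp) (by omega)
    rw [zero_add, htake] at t20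
    have t14 : τ 14 = σ 14 := by rw [tf 14 (by decide) (by decide) (by decide) (by decide)]; simp
    have t13 : τ 13 = σ 13 := by rw [tf 13 (by decide) (by decide) (by decide) (by decide)]; simp
    have b5 := b4.update 18 (v := (gridPoint L p j).enc) (by omega)
    have b6 := b5.update 13 (v := Val.ofList ((gridPoint L p j :: acc).map pointVal)) (by
      rw [h13] at hW
      simp only [List.map_cons, Val.ofList, Val.size_pair, pointVal]
      omega)
    have b7 := b6.update 14 (v := Val.ofList (l.map boxVal)) (by omega)
    obtain ⟨σ', hR2, b8, h13', hf⟩ := ih (gridPoint L p j :: acc) (bs.drop L) _ r b7 hdrop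
      (by
        simp only [Function.update_apply]
        rw [tf 4 (by decide) (by decide) (by decide) (by decide)]
        simpa using h4)
      (by simp) (by simp) hL hBW (by simp; omega) (by
        rw [h13] at hW
        simp [Val.ofList, Val.size_pair, pointVal]
        omega)
    refine ⟨σ', ?_, b8, h13', fun i hi => ?_⟩
    · rw [← List.append_assoc, List.take_append_drop] at hR1
      refine (Reach.while_true hσ (by decide)
        (by simp [Expr.eval, h14, Val.ofList, Val.isPair, Val.toInt])
        (Reach.seq (Reach.assign hσ (by decide) (by simp [Expr.eval]))
        (Reach.seq (Reach.assign b1 (by decide) (by simp [Expr.eval, h4]))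
        (Reach.seq (Reach.assign b2 (by decide) (by simp [Expr.eval]))
        (Reach.seq hR1
        (Reach.seq (Reach.assign b4 (by decide) (by
          simp [Expr.eval, t14, h14, t15, t20, Val.ofList, Val.fst, Val.snd, boxVal, boxDen,
            boxNum, Frac.enc, Val.toInt, ArithOp.apply, gridPoint, hj]))
        (Reach.seq (Reach.assign b5 (by decide) (by
          simp [Expr.eval, t13, h13, Val.ofList, pointVal]))
        (Reach.assign b6 (by decide) (by
          simp [Expr.eval, t14, h14, Val.ofList, Val.snd])))))))) hR2).mono ?_
      rw [htake, List.length_cons, add_mul, one_mul]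
      omega
    · have h13 : i ≠ 13 := by omega
      have h14 : i ≠ 14 := by omega
      have h15 : i ≠ 15 := by omega
      have h16 : i ≠ 16 := by omega
      have h17 : i ≠ 17 := by omega
      have h18 : i ≠ 18 := by omega
      have h20 : i ≠ 20 := by omega
      rw [hf i hi]
      simp only [ne_eq, h13, h14, h18, not_false_eq_true, Function.update_of_ne]
      rw [tf i h15 h16 h17 h20]
      simp [h15, h16, h20]

/-! ### Repeated trials -/

/-- The oracle query for the point in register `13`: the domains of the formula in register `0`
are replaced by the one-point domains. -/
abbrev queryExpr : Expr :=
  .pair (.const 0) (.pair (.reg 13) (.snd (.fst (.reg 0))))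

/-- Samples a grid point and adds to register `11` whether it satisfies the formula. -/
def trial : Prog :=
  .seq (.assign 13 (.const 0))
  (.seq (.assign 14 (.reg 6))
  (.seq samplePoint
  (.seq (.query 19 queryExpr)
  (.seq (.assign 11 (.arith .add (.reg 11) (.reg 19)))
  (.assign 12 (.arith .sub (.reg 12) (.const 1)))))))

/-- As many trials as register `12` says. -/
def trials : Prog := .while (.reg 12) trial

open Classical in
/-- Whether the oracle accepts the query for the grid point sampled with the coin tosses `bs`. -/
noncomputable def trialHit (O : Val → Prop) (body : Val) (L : ℕ) (l : List (Frac × Frac))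
    (bs : List Bool) : ℕ :=
  if O (.pair (.int 0) (.pair (Val.ofList ((gridSample L l bs []).map pointVal)) body))
    then 1 else 0

theorem trialHit_le_one (O : Val → Prop) (body : Val) (L : ℕ) (l : List (Frac × Frac))
    (bs : List Bool) : trialHit O body L l bs ≤ 1 := by
  unfold trialHit; split_ifs <;> simp

theorem reach_trials {O : Val → Prop} {W L B : ℕ} (l : List (Frac × Frac)) (v : Val) (m : ℕ) :
    ∀ (h : ℕ) (bs : List Bool) (σ : ℕ → Val) (r : List Bool), BoundedBy W σ →
    bs.length = m * (l.length * L) → σ 0 = v → σ 4 = .int L → σ 6 = Val.ofList (l.map boxVal) →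
    σ 11 = .int h → σ 12 = .int m → L + 2 ≤ W → B ≤ W →
    6 * (σ 6).size + 6 * L + 14 ≤ B → 1 + l.length * B ≤ W → h + m + 1 ≤ W →
    ∃ σ', Reach O W trials σ (bs ++ r) (m * (l.length * (5 * L + 8) + 7) + 1) σ' r ∧
      BoundedBy W σ' ∧
      σ' 11 = .int (h + hitCount (trialHit O v.fst.snd L l) (l.length * L) m bs : ℕ) ∧
      ∀ i, i < 11 → σ' i = σ i := by
  induction m with
  | zero =>
    intro h bs σ r hσ hbs h0 h4 h6 h11 h12 _ _ _ _ _
    obtain rfl : bs = [] := by simpa using hbs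
    refine ⟨σ, ?_, hσ, h11, fun i _ => rfl⟩
    exact (Reach.while_false hσ (by decide) (by simp [Expr.eval, h12, Val.toInt])).mono (by omega)
  | succ m ih =>
    intro h bs σ r hσ hbs h0 h4 h6 h11 h12 hL hBW hB hW1 hW2
    rw [add_mul, one_mul] at hbs
    set q := l.length * L with hq
    have htake : (bs.take q).length = l.length * L := by rw [List.length_take]; omega
    have hdrop : (bs.drop q).length = m * q := by rw [List.length_drop]; omega
    set Z := trialHit O v.fst.snd L l with hZ
    have hZ1 : Z (bs.take q) ≤ 1 := trialHit_le_one _ _ _ _ _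
    have b1 := hσ.update 13 (v := Val.ofList (([] : List Frac).map pointVal))
      ((Val.size_natCast_le 0).trans (by omega))
    have b2 := b1.update 14 (v := Val.ofList (l.map boxVal)) (h6 ▸ hσ 6)
    obtain ⟨τ, hR1, b3, t13, tf⟩ := reach_samplePoint (O := O) (B := B) l [] (bs.take q) _
      (bs.drop q ++ r) b2 htake (by simpa using h4) (by simp) (by simp) hL hBW
      (by rw [h6] at hB; simpa using hB) (by
        have : (Val.ofList []).size = 1 := by simp [Val.ofList, Val.size]
        simpa [this] using hW1)
    have t0 : τ 0 = v := by rw [tf 0 (by decide)]; simpa using h0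
    have t11 : τ 11 = .int h := by rw [tf 11 (by decide)]; simpa using h11
    have t12 : τ 12 = .int (m + 1 : ℕ) := by rw [tf 12 (by decide)]; simpa using h12
    have b4 := b3.update 19 (v := .int (Z (bs.take q))) ((Val.size_natCast_le _).trans (by omega))
    have b5 := b4.update 11 (v := .int (h + Z (bs.take q) : ℕ))
      ((Val.size_natCast_le _).trans (by omega))
    have b6 := b5.update 12 (v := .int m) ((Val.size_natCast_le _).trans (by omega))
    have t4 : τ 4 = .int L := by rw [tf 4 (by decide)]; simpa using h4
    have t6 : τ 6 = σ 6 := by rw [tf 6 (by decide)]; simp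
    obtain ⟨σ', hR2, b7, h11', hf⟩ := ih (h + Z (bs.take q)) (bs.drop q) _ r b6 hdrop
      (by simpa using t0) (by simpa using t4) (by simpa [t6] using h6) (by simp) (by simp)
      hL hBW (by simpa [t6] using hB) hW1 (by omega)
    refine ⟨σ', ?_, b7, ?_, fun i hi => ?_⟩
    · rw [← List.append_assoc, List.take_append_drop] at hR1
      have hRq : Reach O W (.query 19 queryExpr) τ (bs.drop q ++ r) 1
          (Function.update τ 19 (.int (Z (bs.take q)))) (bs.drop q ++ r) :=
        Reach.query b3 (by decide) (by simp only [Expr.eval, t13, t0])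
      refine (Reach.while_true hσ (by decide)
        (by simp only [Expr.eval, h12, Val.toInt]; omega)
        (Reach.seq (Reach.assign hσ (by decide) (by simp [Expr.eval, Val.ofList]))
        (Reach.seq (Reach.assign b1 (by decide) (by simp [Expr.eval, h6]))
        (Reach.seq hR1
        (Reach.seq hRq
        (Reach.seq (Reach.assign b4 (by decide) (by
          simp [Expr.eval, t11, Val.toInt, ArithOp.apply]))
        (Reach.assign b5 (by decide) (by
          simp [Expr.eval, t12, Val.toInt, ArithOp.apply])))))))
        hR2).mono ?_
      rw [add_mul m 1]
      omega
    · rw [h11', hitCount, add_assoc]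
    · rw [hf i hi]
      have h13 : i ≠ 13 := by omega
      have h14 : i ≠ 14 := by omega
      have h11 : i ≠ 11 := by omega
      have h12 : i ≠ 12 := by omega
      have h19 : i ≠ 19 := by omega
      simp only [ne_eq, h11, h12, h19, not_false_eq_true, Function.update_of_ne]
      rw [tf i (by omega)]
      simp [h13, h14]

/-! ### The sampling algorithm -/

/-- The algorithm.  It counts the inner nodes `c` of the formula, takes `s > 1 / γ`, and makes
`4 * s ^ 2` trials with grid points that have `L = 2 * c + s + 2` random binary digits per
coordinate; the output is the volume of the box times the fraction of successful trials.
Registers: `2` holds `c`, `3` holds `s`, `4` holds `L`, `5` the number of trials, `6` the reversed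
list of domains, `7` and `8` numerator and denominator of the volume of the box, `11` the number of
successes. -/
def approxCount : Prog :=
  .seq (.assign 1 (.pair (.fst (.reg 0)) (.const 0)))
  (.seq countPairs
  (.seq (.assign 3 (.arith .add
    (.arith .div (.snd (.snd (.reg 0))) (.fst (.snd (.reg 0)))) (.const 1)))
  (.seq (.assign 4 (.arith .add (.arith .add (.reg 2) (.reg 2))
    (.arith .add (.reg 3) (.const 2))))
  (.seq (.assign 5 (.arith .mul (.const 4) (.arith .mul (.reg 3) (.reg 3))))
  (.seq (.assign 7 (.const 1))
  (.seq (.assign 8 (.const 1))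
  (.seq (.assign 9 (.fst (.fst (.reg 0))))
  (.seq reverseBox
  (.seq (.assign 12 (.reg 5))
  (.seq trials
  (.assign 0 (.pair (.arith .mul (.reg 7) (.reg 11)) (.arith .mul (.reg 8) (.reg 5))))))))))))))

theorem Val.size_ofList (l : List Val) :
    (Val.ofList l).size = (l.map fun v => v.size + 1).sum + 1 := by
  induction l with
  | nil => simp [Val.ofList, Val.size]
  | cons v l ih => simp only [Val.ofList, Val.size_pair, ih, List.map_cons, List.sum_cons]; omega

theorem Val.size_ofList_reverse (l : List Val) :
    (Val.ofList l.reverse).size = (Val.ofList l).size := by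
  rw [Val.size_ofList, Val.size_ofList, List.map_reverse, List.sum_reverse]

theorem Val.length_le_pairs_ofList (l : List Val) : l.length ≤ (Val.ofList l).pairs := by
  induction l with
  | nil => simp
  | cons v l ih => simp only [Val.ofList, Val.pairs, List.length_cons]; omega

theorem QF.atoms_le_pairs {τ : Type} (e : τ → Val) (φ : QF τ) : φ.atoms ≤ (φ.enc e).pairs := by
  induction φ <;> simp only [QF.atoms, QF.enc, Val.pairs] <;> omega

namespace RAFormula

/-- The list of domains of the free variables. -/
def box (φ : RAFormula) : List (Frac × Frac) := List.ofFn fun i => (φ.lo i, φ.hi i)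

theorem length_box (φ : RAFormula) : φ.box.length = φ.k := by simp [box]

theorem enc_eq (φ : RAFormula) : φ.enc = .pair (Val.ofList (φ.box.map boxVal)) φ.enc.snd := by
  simp only [enc, box, List.map_ofFn, Val.snd]
  rfl

theorem k_add_atoms_le (φ : RAFormula) : φ.k + φ.body.atoms ≤ φ.enc.pairs := by
  have h1 := Val.length_le_pairs_ofList
    (List.ofFn fun i => Val.pair (φ.lo i).enc (φ.hi i).enc)
  have h2 := φ.body.atoms_le_pairs (LinTerm.enc encVar)
  simp only [List.length_ofFn] at h1
  simp only [enc, Val.pairs]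
  omega

end RAFormula

/-- The output of the algorithm after `hits` of `m` trials have been successful. -/
def estimate (l : List (Frac × Frac)) (m : ℕ) (hm : 0 < m) (hits : ℕ) : Frac where
  num := (l.map boxNum).prod * hits
  den := (l.map boxDen).prod * m
  den_pos := Nat.mul_pos (Nat.pos_of_ne_zero (List.prod_ne_zero (by
    simp only [List.mem_map, not_exists, not_and]
    exact fun p _ => (Nat.mul_pos p.1.den_pos p.2.den_pos).ne'))) hm

/-- The algorithm consumes exactly the coin tosses of its trials, and outputs the estimate that
they determine. -/
theorem reach_approxCount {O : Val → Prop} {W : ℕ} (φ : RAFormula) (γ : Frac) {v : Val}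
    (hv : v = .pair φ.enc γ.enc) {c s L m : ℕ} (hc : c = φ.enc.pairs)
    (hs : Int.fdiv γ.den γ.num + 1 = s) (hL : L = 2 * c + s + 2) (hm : m = 4 * (s * s))
    (hm0 : 0 < m) (hWv : v.size ≤ W) (hWL : L + 2 ≤ W) (hWm : m + 1 ≤ W)
    (hWB : 6 * v.size + 6 * L + 14 ≤ W) (hWk : 1 + φ.k * (6 * v.size + 6 * L + 14) ≤ W)
    (bs r : List Bool) (hbs : bs.length = m * (φ.k * L)) :
    ∃ σ', Reach O W approxCount (Function.update (fun _ => Val.int 0) 0 v) (bs ++ r)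
        (4 * v.size + 5 * φ.k + m * (φ.k * (5 * L + 8) + 7) + 20) σ' r ∧
      σ' 0 = (estimate φ.box m hm0
        (hitCount (trialHit O φ.enc.snd L φ.box.reverse) (φ.k * L) m bs)).enc := by
  set σ₀ : ℕ → Val := Function.update (fun _ => Val.int 0) 0 v with hσ₀
  have hγ : 3 ≤ γ.enc.size := by
    have h1 := (Val.int γ.num).one_le_size
    have h2 := (Val.int γ.den).one_le_size
    simp only [Frac.enc, Val.size_pair]
    omega
  have hvs : v.size = φ.enc.size + γ.enc.size + 1 := by rw [hv]; rfl
  have hz : (Val.int 0).size = 1 := by simp [Val.size]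
  have ho : (Val.int 1).size = 2 := by simp [Val.size]
  have hcs : c ≤ φ.enc.size := hc ▸ φ.enc.pairs_le_size
  have b0 : BoundedBy W σ₀ := fun i => by
    rw [hσ₀, Function.update_apply]
    split_ifs
    · exact hWv
    · rw [hz]; omega
  have b1 := b0.update 1 (v := Val.ofList [φ.enc]) (by
    simp only [Val.ofList, Val.size_pair, hz]; omega)
  obtain ⟨τ, hR1, c1, t2, tf⟩ := reach_countPairs (O := O) φ.enc.size [φ.enc] 0 _ (bs ++ r)
    (by simp) b1 (by simp) (by simp [hσ₀]) (by simp [← hc]; omega)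
  replace t2 : τ 2 = .int c := by simpa [← hc] using t2
  have t0 : τ 0 = v := by rw [tf 0 (by decide) (by decide)]; simp [hσ₀]
  have t6 : τ 6 = .int 0 := by rw [tf 6 (by decide) (by decide)]; simp [hσ₀]
  have t11 : τ 11 = .int 0 := by rw [tf 11 (by decide) (by decide)]; simp [hσ₀]
  have c2 := c1.update 3 (v := .int s) ((Val.size_natCast_le _).trans (by omega))
  have c3 := c2.update 4 (v := .int L) ((Val.size_natCast_le _).trans (by omega))
  have c4 := c3.update 5 (v := .int m) ((Val.size_natCast_le _).trans (by omega))
  have c5 := c4.update 7 (v := .int 1) (by rw [ho]; omega)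
  have c6 := c5.update 8 (v := .int (1 : ℕ)) (by rw [Nat.cast_one, ho]; omega)
  have hbox : (Val.ofList (φ.box.map boxVal)).size + 1 ≤ φ.enc.size := by
    rw [φ.enc_eq, Val.size_pair]; omega
  have c7 := c6.update 9 (v := Val.ofList (φ.box.map boxVal)) (by omega)
  obtain ⟨ρ, hR2, d1, r6, r7, r8, rf⟩ := reach_reverseBox (O := O) φ.box [] 1 1 _ (bs ++ r) c7
    (by simp) (by simpa [Val.ofList] using t6) (by simp) (by simp)
    (by simp [t6, hz]; omega) (by simp [ho]; omega) (by simp [ho]; omega)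
  rw [List.append_nil] at r6
  have ρf : ∀ i, i ≠ 3 → i ≠ 4 → i ≠ 5 → i ≠ 6 → i ≠ 7 → i ≠ 8 → i ≠ 9 → ρ i = τ i := by
    intro i h3 h4 h5 h6 h7 h8 h9
    rw [rf i h6 h7 h8 h9]
    simp [h3, h4, h5, h7, h8, h9]
  have r0 : ρ 0 = v := by
    rw [ρf 0 (by decide) (by decide) (by decide) (by decide) (by decide) (by decide) (by decide), t0]
  have r11 : ρ 11 = .int (0 : ℕ) := by
    rw [ρf 11 (by decide) (by decide) (by decide) (by decide) (by decide) (by decide) (by decide),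
      t11, Nat.cast_zero]
  have r4 : ρ 4 = .int L := by
    rw [rf 4 (by decide) (by decide) (by decide) (by decide)]; simp
  have r5 : ρ 5 = .int m := by
    rw [rf 5 (by decide) (by decide) (by decide) (by decide)]; simp
  have d2 := d1.update 12 (v := .int m) ((Val.size_natCast_le _).trans (by omega))
  have hrev : (Val.ofList (φ.box.reverse.map boxVal)).size ≤ v.size := by
    rw [List.map_reverse, Val.size_ofList_reverse]; omega
  obtain ⟨η, hR3, e1, e11, ef⟩ := reach_trials (O := O) (L := L)
    (B := 6 * v.size + 6 * L + 14) φ.box.reverse v m 0 bs _ r d2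
    (by rw [List.length_reverse, φ.length_box]; exact hbs) (by simpa using r0)
    (by simpa using r4) (by simpa using r6) (by simpa using r11) (by simp) hWL hWB
    (by simp [r6]; simpa using hrev) (by rw [List.length_reverse, φ.length_box]; exact hWk)
    (by omega)
  rw [List.length_reverse, φ.length_box] at hR3 e11
  rw [zero_add, show v.fst.snd = φ.enc.snd by rw [hv]; rfl] at e11
  have e5 : η 5 = .int m := by rw [ef 5 (by decide)]; simpa using r5
  have e7 : η 7 = .int (φ.box.map boxNum).prod := by
    rw [ef 7 (by decide)]; simpa using r7
  have e8 : η 8 = .int ((φ.box.map boxDen).prod : ℕ) := by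
    rw [ef 8 (by decide)]; simpa using r8
  refine ⟨Function.update η 0 (estimate φ.box m hm0
    (hitCount (trialHit O φ.enc.snd L φ.box.reverse) (φ.k * L) m bs)).enc, ?_, by simp⟩
  refine (Reach.seq (Reach.assign b0 (by decide) (by
      simp [Expr.eval, hσ₀, hv, Val.fst, Val.ofList]))
    (Reach.seq hR1
    (Reach.seq (Reach.assign c1 (by decide) (by
      simp [Expr.eval, t0, hv, Frac.enc, Val.fst, Val.snd, Val.toInt, ArithOp.apply, hs]))
    (Reach.seq (Reach.assign c2 (by decide) (by
      simp [Expr.eval, t2, Val.toInt, ArithOp.apply, hL]; ring))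
    (Reach.seq (Reach.assign c3 (by decide) (by
      simp [Expr.eval, Val.toInt, ArithOp.apply, hm]))
    (Reach.seq (Reach.assign c4 (by decide) (by simp [Expr.eval]))
    (Reach.seq (Reach.assign c5 (by decide) (by simp [Expr.eval]))
    (Reach.seq (Reach.assign c6 (by decide) (by
      simp only [Expr.eval, ne_eq, OfNat.zero_ne_ofNat, not_false_eq_true,
        Function.update_of_ne, t0]
      rw [hv, Val.fst, φ.enc_eq, Val.fst]))
    (Reach.seq hR2
    (Reach.seq (Reach.assign d1 (by decide) (by simp [Expr.eval, r5]))
    (Reach.seq hR3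
    (Reach.assign e1 (by decide) (by
      simp [Expr.eval, e5, e7, e8, e11, Val.toInt, ArithOp.apply, estimate, Frac.enc]))))))))))))).mono
      ?_
  rw [φ.length_box]
  omega

/-! ### The distribution of the sampled point -/

/-- The sampled point is uniformly distributed on the grid. -/
theorem coinAvg_gridSample (L : ℕ) : ∀ {k : ℕ} (D : Fin k → Frac × Frac) (acc : List Frac)
    (F : List Frac → ℝ),
    coinAvg (k * L) (fun bs => F (gridSample L (List.ofFn D).reverse bs acc)) =
      (∑ j : Fin k → Fin (2 ^ L), F ((List.ofFn fun i => gridPoint L (D i) (j i)) ++ acc)) /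
        (2 ^ L) ^ k := by
  intro k
  induction k with
  | zero => intro D acc F; simp [coinAvg, gridSample]
  | succ k ih =>
    intro D acc F
    have h1 : ∀ l l' : List Bool, l.length = L →
        gridSample L (List.ofFn D).reverse (l ++ l') acc =
          gridSample L (List.ofFn fun i : Fin k => D i.castSucc).reverse l'
            (gridPoint L (D (Fin.last k)) (bitsNat 0 l) :: acc) := by
      intro l l' hl
      rw [List.ofFn_succ', List.concat_eq_append, List.reverse_append, List.reverse_singleton,
        List.singleton_append, gridSample, List.take_left' hl, List.drop_left' hl]
    rw [show (k + 1) * L = L + k * L by ring, coinAvg_append]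
    let G : ℕ → ℝ := fun i => (∑ j : Fin k → Fin (2 ^ L),
      F ((List.ofFn fun i => gridPoint L (D i.castSucc) (j i)) ++
        gridPoint L (D (Fin.last k)) i :: acc)) / (2 ^ L) ^ k
    calc _ = coinAvg L fun l => G (bitsNat 0 l) := by
          refine coinAvg_congr fun l hl => ?_
          simp only [h1 l _ hl]
          exact ih _ _ _
      _ = _ := by
          rw [coinAvg_bitsNat L 0 G, ← Equiv.sum_comp (Fin.snocEquiv fun _ => Fin (2 ^ L)),
            Fintype.sum_prod_type, pow_succ,
            ← Fin.sum_univ_eq_sum_range fun i => G (0 * 2 ^ L + i)]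
          simp only [G]
          rw [← Finset.sum_div, div_div]
          congr 1
          refine Finset.sum_congr rfl fun i _ => Finset.sum_congr rfl fun j _ => ?_
          rw [List.ofFn_succ' (n := k)]
          simp [Fin.snocEquiv]

theorem gridPoint_val (L : ℕ) (lo hi : Frac) (j : ℕ) :
    ((gridPoint L (lo, hi) j).val : ℝ) =
      (lo.val : ℝ) + ((hi.val : ℝ) - (lo.val : ℝ)) * j / (2 ^ L : ℕ) := by
  have h1 : (lo.den : ℝ) ≠ 0 := by exact_mod_cast lo.den_pos.ne'
  have h2 : (hi.den : ℝ) ≠ 0 := by exact_mod_cast hi.den_pos.ne'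
  simp only [Frac.val, gridPoint, boxNum, boxDen]
  push_cast
  field_simp

namespace RAFormula

/-- The probability that one trial succeeds is the fraction of the grid points that satisfy the
formula. -/
theorem coinAvg_trialHit (φ : RAFormula) (L : ℕ) :
    coinAvg (φ.k * L) (fun bs => (trialHit mixSatOracle φ.enc.snd L φ.box.reverse bs : ℝ)) =
      (∑ j : Fin φ.k → Fin (2 ^ L), φ.solutions.indicator (fun _ => (1 : ℝ)) fun i =>
        ((φ.lo i).val : ℝ) + (((φ.hi i).val : ℝ) - ((φ.lo i).val : ℝ)) * (j i : ℕ) /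
          (2 ^ L : ℕ)) / (2 ^ L : ℕ) ^ φ.k := by
  classical
  let F : List Frac → ℝ := fun xs =>
    if mixSatOracle (.pair (.int 0) (.pair (Val.ofList (xs.map pointVal)) φ.enc.snd))
      then 1 else 0
  have hF : ∀ bs, (trialHit mixSatOracle φ.enc.snd L φ.box.reverse bs : ℝ) =
      F (gridSample L (List.ofFn fun i => (φ.lo i, φ.hi i)).reverse bs []) := by
    intro bs
    by_cases hO : mixSatOracle (.pair (.int 0) (.pair
        (Val.ofList ((gridSample L φ.box.reverse bs []).map pointVal)) φ.enc.snd))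
    · rw [trialHit, if_pos hO, Nat.cast_one]
      exact (if_pos hO).symm
    · rw [trialHit, if_neg hO, Nat.cast_zero]
      exact (if_neg hO).symm
  rw [show ((2 ^ L : ℕ) : ℝ) = 2 ^ L by push_cast; rfl, coinAvg_congr fun bs _ => hF bs,
    coinAvg_gridSample L (fun i => (φ.lo i, φ.hi i)) [] F]
  congr 1
  refine Finset.sum_congr rfl fun j _ => ?_
  have h' := φ.mixSatOracle_atPoint fun i => gridPoint L (φ.lo i, φ.hi i) (j i)
  simp only [gridPoint_val] at h'
  push_cast at h'
  simp only [F]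
  rw [indicator_apply, List.append_nil, List.map_ofFn]
  exact if_congr h' rfl rfl

/-- On a grid with at least `2 ^ (2 * c + s + 2)` points per coordinate, where `c` bounds the
number of variables and comparisons and `1 / γ ≤ s`, the discretization error is half of the
error allowed. -/
theorem abs_modelCount_sub_le (φ : RAFormula) {c s L : ℕ} (hc : φ.k + φ.body.atoms ≤ c)
    (hL : L = 2 * c + s + 2) {γ : ℝ} (hγ : 0 < γ) (hs : 1 ≤ γ * s) :
    |φ.modelCount - φ.boxVolume * coinAvg (φ.k * L) fun bs =>
      (trialHit mixSatOracle φ.enc.snd L φ.box.reverse bs : ℝ)| ≤ φ.boxVolume * (γ / 2) := by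
  have h := grid_approx (N := 2 ^ L) (by positivity) φ.lo_le_hi_real φ.isConvexUnion_solutions
  rw [← models_eq] at h
  rw [coinAvg_trialHit]
  refine h.trans (mul_le_mul_of_nonneg_left ?_ φ.boxVolume_nonneg)
  have hpow : (0 : ℝ) < (2 ^ L : ℕ) := by positivity
  rw [← mul_div_assoc, div_le_iff₀ hpow]
  have h1 : (φ.k : ℝ) * 3 ^ φ.body.atoms ≤ 4 ^ c := by
    have hk : φ.k ≤ 4 ^ φ.k := (Nat.lt_pow_self (by norm_num)).le
    have ha : 3 ^ φ.body.atoms ≤ 4 ^ φ.body.atoms := Nat.pow_le_pow_left (by norm_num) _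
    have := (Nat.mul_le_mul hk ha).trans_eq (pow_add 4 _ _).symm
    exact_mod_cast this.trans (Nat.pow_le_pow_right (by norm_num) hc)
  have h2 : 1 ≤ γ * 2 ^ s := hs.trans (mul_le_mul_of_nonneg_left
    (by exact_mod_cast Nat.lt_two_pow_self.le) hγ.le)
  have h3 : ((2 ^ L : ℕ) : ℝ) = 4 * 4 ^ c * 2 ^ s := by
    rw [hL, pow_add, pow_add, pow_mul]; push_cast; ring
  rw [h3]
  push_cast
  have h4 : (4 : ℝ) ^ c ≤ 4 ^ c * (γ * 2 ^ s) := le_mul_of_one_le_right (by positivity) h2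
  linarith

theorem estimate_val (φ : RAFormula) {m : ℕ} (hm : 0 < m) (hits : ℕ) :
    ((estimate φ.box m hm hits).val : ℝ) = φ.boxVolume * (hits / m) := by
  have hV : φ.boxVolume = ((φ.box.map boxNum).prod : ℝ) / ((φ.box.map boxDen).prod : ℕ) := by
    rw [boxVolume, box, List.map_ofFn, List.map_ofFn, List.prod_ofFn, List.prod_ofFn]
    push_cast
    rw [← Finset.prod_div_distrib]
    refine Finset.prod_congr rfl fun i _ => ?_
    have h1 : ((φ.lo i).den : ℝ) ≠ 0 := by exact_mod_cast (φ.lo i).den_pos.ne'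
    have h2 : ((φ.hi i).den : ℝ) ≠ 0 := by exact_mod_cast (φ.hi i).den_pos.ne'
    simp only [Function.comp, boxNum, boxDen, Frac.val]
    push_cast
    field_simp
  rw [hV, Frac.val]
  simp only [estimate]
  generalize (φ.box.map boxNum).prod = a
  generalize (φ.box.map boxDen).prod = b
  push_cast
  rw [div_mul_div_comm]

end RAFormula

/-! ### Running time and error probability -/

/-- The integer quotient `s = ⌊1 / γ⌋ + 1` that the algorithm computes. -/
theorem exists_inv_bound (γ : Frac) (hγ : 0 < γ.val) :
    ∃ s : ℕ, Int.fdiv γ.den γ.num + 1 = s ∧ s ≤ ⌈γ.val⁻¹⌉₊ + 1 ∧ 1 ≤ (γ.val : ℝ) * s := by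
  have hd : (0 : ℚ) < γ.den := by exact_mod_cast γ.den_pos
  have hn : 0 < γ.num := by
    have : (0 : ℚ) < γ.num := by
      rw [Frac.val, lt_div_iff₀ hd, zero_mul] at hγ; exact hγ
    exact_mod_cast this
  obtain ⟨a, ha⟩ : ∃ a : ℕ, γ.num = a := ⟨γ.num.toNat, (Int.toNat_of_nonneg hn.le).symm⟩
  have ha0 : 0 < a := by omega
  have hval : γ.val = (a : ℚ) / γ.den := by rw [Frac.val, ha, Int.cast_natCast]
  refine ⟨γ.den / a + 1, ?_, ?_, ?_⟩
  · rw [ha, Int.fdiv_eq_ediv_of_nonneg _ (Int.natCast_nonneg a)]; push_cast; rfl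
  · have : ((γ.den / a : ℕ) : ℚ) ≤ γ.val⁻¹ := by
      rw [hval, inv_div]; exact Nat.cast_div_le
    have := Nat.cast_le.1 (this.trans (Nat.le_ceil _))
    omega
  · have h1 : γ.den < (γ.den / a + 1) * a := by
      have := Nat.lt_mul_div_succ γ.den ha0
      rwa [mul_comm] at this
    have h2 : (γ.den : ℝ) < ((γ.den / a + 1 : ℕ) : ℝ) * a := by exact_mod_cast h1
    have hd' : (0 : ℝ) < γ.den := by exact_mod_cast γ.den_pos
    rw [hval]
    push_cast at h2 ⊢
    rw [div_mul_eq_mul_div, le_div_iff₀ hd']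
    linarith

/-- All the quantities that govern the run are bounded by powers of `y`, which stands for the
length of the input plus `⌈1 / γ⌉ + 1`; registers never exceed the size `50 * y ^ 2`. -/
theorem approxCount_bounds {k z c s L m y : ℕ} (hk : k ≤ y) (hz : z ≤ y) (hcs : 2 * c + s ≤ 2 * y)
    (hs : s ≤ y) (hy : 1 ≤ y) (hL : L = 2 * c + s + 2) (hm : m = 4 * (s * s)) :
    L + 2 ≤ 50 * y ^ 2 ∧ m + 1 ≤ 50 * y ^ 2 ∧ 6 * z + 6 * L + 14 ≤ 50 * y ^ 2 ∧
      1 + k * (6 * z + 6 * L + 14) ≤ 50 * y ^ 2 ∧ m * (k * L) ≤ 10 ^ 8 * y ^ 8 ∧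
      (4 * z + 5 * k + m * (k * (5 * L + 8) + 7) + 20) * unitCost (50 * y ^ 2) ≤
        10 ^ 8 * y ^ 8 := by
  have hy2 : y ≤ y ^ 2 := Nat.le_self_pow two_ne_zero y
  have hy4 : y ^ 2 ≤ y ^ 4 := Nat.pow_le_pow_right hy (by norm_num)
  have hy8 : y ^ 4 ≤ y ^ 8 := Nat.pow_le_pow_right hy (by norm_num)
  have hLy : L ≤ 4 * y := by omega
  have hmy : m ≤ 4 * y ^ 2 := by
    rw [hm, sq]; exact Nat.mul_le_mul_left 4 (Nat.mul_le_mul hs hs)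
  have hB : 6 * z + 6 * L + 14 ≤ 44 * y := by omega
  have hkB : k * (6 * z + 6 * L + 14) ≤ 44 * y ^ 2 :=
    (Nat.mul_le_mul hk hB).trans_eq (by ring)
  have hmkL : m * (k * L) ≤ 16 * y ^ 4 :=
    (Nat.mul_le_mul hmy (Nat.mul_le_mul hk hLy)).trans_eq (by ring)
  have h5 : k * (5 * L + 8) + 7 ≤ 35 * y ^ 2 := by
    have : k * (5 * L + 8) ≤ 28 * y ^ 2 :=
      (Nat.mul_le_mul hk (show 5 * L + 8 ≤ 28 * y by omega)).trans_eq (by ring)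
    omega
  have h6 : m * (k * (5 * L + 8) + 7) ≤ 140 * y ^ 4 :=
    (Nat.mul_le_mul hmy h5).trans_eq (by ring)
  refine ⟨by omega, by omega, by omega, by omega, by omega, ?_⟩
  calc _ ≤ 200 * y ^ 4 * (128 * (50 * y ^ 2) ^ 2) :=
        Nat.mul_le_mul (by omega) (by rw [unitCost])
    _ = 64000000 * y ^ 8 := by ring
    _ ≤ _ := Nat.mul_le_mul_right _ (by norm_num)

theorem theorem2 :
    (∀ φ : RAFormula, |φ.modelCount| ≤ φ.boxVolume) ∧
    ∃ (M : Prog) (p : Polynomial ℕ), ∀ (φ : RAFormula) (γ : Frac), 0 < γ.val →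
      ∀ T : ℕ, T = p.eval ((Val.pair φ.enc γ.enc).size + ⌈γ.val⁻¹⌉₊) →
        (∀ r : Fin T → Bool, ∃ w : Val,
          M.Outputs mixSatOracle (Val.pair φ.enc γ.enc) T r w) ∧
        3 / 4 ≤ coinProb T fun r => ∃ a : Frac,
          M.Outputs mixSatOracle (Val.pair φ.enc γ.enc) T r a.enc ∧
            |(a.val : ℝ) - φ.modelCount| ≤ (γ.val : ℝ) * φ.boxVolume := by
  classical
  refine ⟨fun φ => ?_, approxCount, Polynomial.C (10 ^ 8) * (Polynomial.X + 1) ^ 8, ?_⟩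
  · rw [abs_of_nonneg φ.modelCount_nonneg]
    exact φ.modelCount_le_boxVolume
  intro φ γ hγ T hT
  obtain ⟨s, hfdiv, hs, hs1⟩ := exists_inv_bound γ hγ
  have hγ' : (0 : ℝ) < γ.val := by exact_mod_cast hγ
  set v := Val.pair φ.enc γ.enc with hv
  set y := v.size + ⌈γ.val⁻¹⌉₊ + 1 with hy
  have hT' : T = 10 ^ 8 * y ^ 8 := by rw [hT]; simp [hy]
  set c := φ.enc.pairs with hc
  set L := 2 * c + s + 2 with hL
  set m := 4 * (s * s) with hm
  have hs0 : 0 < s := Nat.pos_of_ne_zero fun h => by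
    rw [h] at hs1; norm_num at hs1
  have hm0 : 0 < m := by positivity
  have hcv : 2 * c + 1 ≤ φ.enc.size := φ.enc.two_mul_pairs_lt_size
  have hvs : v.size = φ.enc.size + γ.enc.size + 1 := rfl
  have hkc := φ.k_add_atoms_le
  obtain ⟨w1, w2, w3, w4, w5, w6⟩ := approxCount_bounds (k := φ.k) (z := v.size) (y := y)
    (by omega) (by omega) (by omega) (by omega) (by omega) hL hm
  rw [← hT'] at w5 w6
  set Z := trialHit mixSatOracle φ.enc.snd L φ.box.reverse with hZ
  set q := φ.k * L with hq
  have hrun : ∀ r : Fin T → Bool, approxCount.Outputs mixSatOracle v T r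
      (estimate φ.box m hm0 (hitCount Z q m ((List.ofFn r).take (m * q)))).enc := by
    intro r
    have hlen : ((List.ofFn r).take (m * q)).length = m * q := by
      rw [List.length_take, List.length_ofFn]; omega
    obtain ⟨σ', ⟨t, ht, hE⟩, h0⟩ := reach_approxCount (O := mixSatOracle) φ γ hv hc hfdiv hL hm hm0
      (by omega) w1 w2 w3 w4 _ ((List.ofFn r).drop (m * q)) hlen
    rw [List.take_append_drop] at hE
    exact ⟨t, σ', _, hE, ht.trans w6, h0⟩
  refine ⟨fun r => ⟨_, hrun r⟩, ?_⟩
  set p := coinAvg q fun bs => (Z bs : ℝ) with hp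
  have hdisc := φ.abs_modelCount_sub_le hkc hL hγ' hs1
  have hVp : 0 ≤ φ.boxVolume := φ.boxVolume_nonneg
  have hconc := hitCount_concentration Z (trialHit_le_one _ _ _ _) q m hp (half_pos hγ')
    (by rw [hm]; push_cast; nlinarith) (T - m * q)
  rw [Nat.add_sub_cancel' w5] at hconc
  refine le_coinProb (P := fun l =>
    |(hitCount Z q m (l.take (m * q)) : ℝ) - m * p| ≤ m * (γ.val / 2)) (fun r hr => ?_) hconc
  refine ⟨_, hrun r, ?_⟩
  rw [φ.estimate_val]
  set H := hitCount Z q m ((List.ofFn r).take (m * q)) with hH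
  have hm' : (0 : ℝ) < m := by exact_mod_cast hm0
  have hmean : |(H : ℝ) / m - p| ≤ γ.val / 2 := by
    have hr' : |(H : ℝ) - m * p| ≤ m * (γ.val / 2) := hr
    rw [show (H : ℝ) / m - p = (H - m * p) / m by field_simp, abs_div, abs_of_pos hm',
      div_le_iff₀ hm']
    linarith
  calc _ ≤ |φ.boxVolume * (H / m) - φ.boxVolume * p| + |φ.boxVolume * p - φ.modelCount| :=
        abs_sub_le _ _ _
    _ ≤ φ.boxVolume * (γ.val / 2) + φ.boxVolume * (γ.val / 2) := by
        refine add_le_add ?_ (by rw [abs_sub_comm]; exact hdisc)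
        rw [← mul_sub, abs_mul, abs_of_nonneg hVp]
        exact mul_le_mul_of_nonneg_left hmean hVp
    _ = _ := by ring
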